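/- **Setting.** Let $X$ be a complex Banach space and $(F(s))_{s\in[0,1]}$ a family of bounded operators on $X$. The *peripheral spectrum* of an operator is the set of points of its spectrum whose modulus is the spectral radius $\operatorname{spr}$; an isolated point $\mu$ of the spectrum of $A$, with Riesz projector $P_\mu$, is a *semisimple eigenvalue* if it is an eigenvalue and $AP_\mu=\mu P_\mu$. The family is *admissible* if: * $s\mapsto F(s)$ is norm continuous on $[0,1]$, and $\operatorname{spr}F(s)=1$ for all $s$; * for every $s$ the peripheral spectrum of $F(s)$ consists of finitely many isolated semisimple eigenvalues, and these do not cross, i.e. their number $z$ is independent of $s$; * with $P(s)$ the spectral projector of $F(s)$ onto the peripheral eigenvalues, $s\mapsto F(s)P(s)$ is $C^2$ on $[0,1]$ in operator norm; * with $Q(s)=\mathrm{Id}-P(s)$, $\ \ell:=\sup_{s\in[0,1]}\operatorname{spr}F(s)Q(s)<1$. **Theorem.** Let $(F(s))_{s\in[0,1]}$ be admissible. The peripheral eigenvalues can be labelled as pairwise distinct continuous functions $\lambda^1(s),\dots,\lambda^z(s)$ on $[0,1]$. For every such labelling, $\lambda^m$ and the associated spectral projectors $P^m$ are $C^2$ on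 $[0,1]$, and there is a family of intertwining operators $W$ for the projectors $P^1,\dots,P^z,Q$, i.e. a solution on $[0,1]$ of $$W'(s)=\Big(\sum_{m=1}^z P^m{}'(s)P^m(s)+Q'(s)Q(s)\Big)W(s),\qquad W(0)=\mathrm{Id}.$$ Put $F^Q(s)=Q(s)F(s)$. For every such labelling and every such $W$, and for every $\ell'\in(\ell,1)$, there exist $C>0$ and $T_0\in\mathbb N$ such that for all integers $T\ge T_0$ and $1\le k\le T$ $$\Big\|F(\tfrac kT)\cdots F(\tfrac1T)-\sum_{m=1}^z\Big(\prod_{n=1}^k\lambda^m(\tfrac nT)\Big)W(\tfrac kT)P^m(0)-F^Q(\tfrac kT)\cdots F^Q(\tfrac1T)Q(0)\Big\|\le\frac{C}{T(1-\ell')}$$ and $$\big\|F^Q(\tfrac kT)\cdots F^Q(\tfrac1T)Q(0)\big\|\le C\,\ell'^{\,k}.$$ **Dependence of the constants.** Let $C_P$ be the supremum over $s\in[0,1]$ of the norms of $P^1(s),\dots,P^z(s),Q(s)$ and of their derivatives. Fix $\ell'<1$, $\delta>0$, real numbers $M$ and $q$, $0\le r<\ell'$, an integer $N\ge1$ and a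 function $\omega$ with $\omega(t)\to0$ as $t\downarrow0$. Then there are a continuous function $c:\mathbb R\to(0,\infty)$ and a function $\tau:\mathbb R\to\mathbb N$ such that both estimates hold with $C=c(C_P)$ and $T_0=\tau(C_P)$ for all Banach spaces $X$, all admissible families on $X$, all continuous labellings and all $W$ as above for which, for all $s,t\in[0,1]$, $$|\lambda^i(s)-\lambda^j(s)|\ge\delta\ (i\ne j),\quad |\lambda^m{}'(s)|\le M,\quad \|P^m{}''(s)\|\le M,$$ $$\|F^Q(s)\|\le q,\quad \|F^Q(s)^N\|\le r^N,\quad \|F^Q(s)-F^Q(t)\|\le\omega(|s-t|).$$ -/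

import Mathlib

open Set Filter Topology
open scoped ENNReal

universe u

noncomputable section

namespace DiscreteAdiabatic

/-- The point `μ` of the spectrum of `A` is isolated in the spectrum. -/
def IsIsolatedInSpectrum {X : Type u} [NormedAddCommGroup X] [NormedSpace ℂ X]
    (A : X →L[ℂ] X) (μ : ℂ) : Prop :=
  μ ∈ spectrum ℂ A ∧ ∃ r : ℝ, 0 < r ∧ spectrum ℂ A ∩ Metric.closedBall μ r ⊆ {μ}

open Classical in
/-- The (Riesz) spectral projector `(2πi)⁻¹ ∮ (z - A)⁻¹ dz` of `A` at an isolated point `μ` of its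
spectrum. The contour is a circle about `μ` such that the closed disc it bounds contains no other
point of the spectrum; the value does not depend on the circle. (It is `0` if `μ` is not an
isolated point of the spectrum.) -/
def spectralProjector {X : Type u} [NormedAddCommGroup X] [NormedSpace ℂ X]
    (A : X →L[ℂ] X) (μ : ℂ) : X →L[ℂ] X :=
  if h : IsIsolatedInSpectrum A μ then
    (2 * (Real.pi : ℂ) * Complex.I)⁻¹ • ∮ z in C(μ, h.2.choose), resolvent A z
  else 0

/-- An isolated point `μ` of the spectrum that is a semisimple eigenvalue: it is an eigenvalue, and
`A` acts as multiplication by `μ` on the whole range of the spectral projector. -/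
def IsIsolatedSemisimpleEigenvalue {X : Type u} [NormedAddCommGroup X] [NormedSpace ℂ X]
    (A : X →L[ℂ] X) (μ : ℂ) : Prop :=
  IsIsolatedInSpectrum A μ ∧ Module.End.HasEigenvalue (A : X →ₗ[ℂ] X) μ ∧
    A * spectralProjector A μ = μ • spectralProjector A μ

/-- The peripheral spectrum: the points of the spectrum whose modulus is the spectral radius. -/
def peripheralSpectrum {X : Type u} [NormedAddCommGroup X] [NormedSpace ℂ X]
    (A : X →L[ℂ] X) : Set ℂ :=
  {μ | μ ∈ spectrum ℂ A ∧ ENNReal.ofReal ‖μ‖ = spectralRadius ℂ A}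

/-- The spectral projector `P` onto the peripheral eigenvalues (used when these are finitely many
isolated points of the spectrum). -/
def peripheralProjector {X : Type u} [NormedAddCommGroup X] [NormedSpace ℂ X]
    (A : X →L[ℂ] X) : X →L[ℂ] X :=
  ∑ᶠ μ ∈ peripheralSpectrum A, spectralProjector A μ

/-- `Q = Id - P`. -/
def complProjector {X : Type u} [NormedAddCommGroup X] [NormedSpace ℂ X]
    (A : X →L[ℂ] X) : X →L[ℂ] X :=
  1 - peripheralProjector A

/-- `ℓ`, the supremum over `s ∈ [0,1]` of the spectral radius of `F(s) Q(s)`. -/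
def innerRadius {X : Type u} [NormedAddCommGroup X] [NormedSpace ℂ X]
    (F : ℝ → X →L[ℂ] X) : ℝ≥0∞ :=
  ⨆ s ∈ Icc (0 : ℝ) 1, spectralRadius ℂ (F s * complProjector (F s))

/-- Admissible families `(F(s))`, `s ∈ [0,1]`. Only the values of `F` on `[0,1]` matter. -/
structure Admissible {X : Type u} [NormedAddCommGroup X] [NormedSpace ℂ X]
    (F : ℝ → X →L[ℂ] X) : Prop where
  /-- `s ↦ F(s)` is norm continuous on `[0,1]`. -/
  continuousOn : ContinuousOn F (Icc 0 1)
  spectralRadius_eq_one : ∀ s ∈ Icc (0 : ℝ) 1, spectralRadius ℂ (F s) = 1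
  finite_peripheral : ∀ s ∈ Icc (0 : ℝ) 1, (peripheralSpectrum (F s)).Finite
  semisimple : ∀ s ∈ Icc (0 : ℝ) 1, ∀ μ ∈ peripheralSpectrum (F s),
    IsIsolatedSemisimpleEigenvalue (F s) μ
  /-- The peripheral eigenvalues do not cross: their number `z` does not depend on `s`. -/
  no_crossing : ∃ z : ℕ, ∀ s ∈ Icc (0 : ℝ) 1, (peripheralSpectrum (F s)).ncard = z
  /-- `s ↦ F(s) P(s)` is `C²` on `[0,1]` in operator norm. -/
  contDiffOn : ContDiffOn ℝ 2 (fun s => F s * peripheralProjector (F s)) (Icc 0 1)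
  innerRadius_lt_one : innerRadius F < 1

/-- `lam 0, …, lam (z - 1)` is a continuous labelling of the peripheral eigenvalues of `F(s)`,
`s ∈ [0,1]`, without repetition. -/
structure IsPeripheralLabelling {X : Type u} [NormedAddCommGroup X] [NormedSpace ℂ X]
    (F : ℝ → X →L[ℂ] X) {z : ℕ} (lam : Fin z → ℝ → ℂ) : Prop where
  continuousOn : ∀ m, ContinuousOn (lam m) (Icc 0 1)
  injective : ∀ s ∈ Icc (0 : ℝ) 1, Function.Injective (fun m => lam m s)
  range_eq : ∀ s ∈ Icc (0 : ℝ) 1, range (fun m => lam m s) = peripheralSpectrum (F s)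

/-- The spectral projector `P^m(s)` of `F(s)` at the eigenvalue `lam m s`. -/
def eigenProjector {X : Type u} [NormedAddCommGroup X] [NormedSpace ℂ X]
    (F : ℝ → X →L[ℂ] X) {z : ℕ} (lam : Fin z → ℝ → ℂ) (m : Fin z) (s : ℝ) : X →L[ℂ] X :=
  spectralProjector (F s) (lam m s)

/-- The complete family of projectors consisting of the `P^m(s)` (at `some m`) and of `Q(s)`
(at `none`); their sum is the identity. -/
def projectorFamily {X : Type u} [NormedAddCommGroup X] [NormedSpace ℂ X]
    (F : ℝ → X →L[ℂ] X) {z : ℕ} (lam : Fin z → ℝ → ℂ) : Option (Fin z) → ℝ → X →L[ℂ] X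
  | some m => eigenProjector F lam m
  | none => fun s => complProjector (F s)

/-- `W` is the family of intertwining operators of the family of projectors `P`: on `[0,1]`,
`W'(s) = ∑ᵢ Pᵢ'(s) Pᵢ(s) W(s)` and `W(0) = Id` (one-sided derivatives at the end points). -/
structure IsIntertwiner {X : Type u} [NormedAddCommGroup X] [NormedSpace ℂ X]
    {ι : Type} [Fintype ι] (P : ι → ℝ → X →L[ℂ] X) (W : ℝ → X →L[ℂ] X) : Prop where
  zero : W 0 = 1
  hasDerivWithinAt : ∀ s ∈ Icc (0 : ℝ) 1,
    HasDerivWithinAt W ((∑ i, derivWithin (P i) (Icc 0 1) s * P i s) * W s) (Icc 0 1) s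

/-- `C_P`, the supremum over `s ∈ [0,1]` and `i` of `max (‖Pᵢ(s)‖, ‖Pᵢ'(s)‖)`. -/
def projectorBound {X : Type u} [NormedAddCommGroup X] [NormedSpace ℂ X]
    {ι : Type} [Fintype ι] (P : ι → ℝ → X →L[ℂ] X) : ℝ :=
  ⨆ s : Icc (0 : ℝ) 1, ⨆ i, max ‖P i s‖ ‖derivWithin (P i) (Icc 0 1) s‖

/-- The ordered product `A(k/T) ⋯ A(2/T) A(1/T)` (the identity for `k = 0`). -/
def orderedProduct {X : Type u} [NormedAddCommGroup X] [NormedSpace ℂ X]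
    (A : ℝ → X →L[ℂ] X) (T : ℕ) : ℕ → X →L[ℂ] X
  | 0 => 1
  | k + 1 => A (((k + 1 : ℕ) : ℝ) / (T : ℝ)) * orderedProduct A T k

/-- `F^Q(s) = Q(s) F(s)`. -/
def innerPart {X : Type u} [NormedAddCommGroup X] [NormedSpace ℂ X]
    (F : ℝ → X →L[ℂ] X) (s : ℝ) : X →L[ℂ] X :=
  complProjector (F s) * F s

/-- The adiabatic approximation and the decay of the `Q`-part, with the constants `C` and `T₀`. -/
def AdiabaticEstimate {X : Type u} [NormedAddCommGroup X] [NormedSpace ℂ X]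
    (F : ℝ → X →L[ℂ] X) {z : ℕ} (lam : Fin z → ℝ → ℂ) (W : ℝ → X →L[ℂ] X)
    (l' C : ℝ) (T₀ : ℕ) : Prop :=
  ∀ T : ℕ, T₀ ≤ T → ∀ k : ℕ, 1 ≤ k → k ≤ T →
    ‖orderedProduct F T k
        - ∑ m, (∏ n ∈ Finset.Icc 1 k, lam m ((n : ℝ) / (T : ℝ))) •
            (W ((k : ℝ) / (T : ℝ)) * eigenProjector F lam m 0)
        - orderedProduct (innerPart F) T k * complProjector (F 0)‖ ≤ C / ((T : ℝ) * (1 - l')) ∧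
    ‖orderedProduct (innerPart F) T k * complProjector (F 0)‖ ≤ C * l' ^ k

/-- Quantitative data of an admissible family other than `C_P`: the separation `δ` of the peripheral
eigenvalues, a bound `M` on the `(λ^m)'` and the `(P^m)''`, and, for the `Q`-part, a bound `q` on
the norm, a modulus of continuity `ω` and a power `N` with `‖F^Q(s)^N‖ ≤ r^N`. -/
structure HasBounds {X : Type u} [NormedAddCommGroup X] [NormedSpace ℂ X]
    (F : ℝ → X →L[ℂ] X) {z : ℕ} (lam : Fin z → ℝ → ℂ)
    (δ M q r : ℝ) (N : ℕ) (ω : ℝ → ℝ) : Prop where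
  separation : ∀ s ∈ Icc (0 : ℝ) 1, ∀ i j, i ≠ j → δ ≤ ‖lam i s - lam j s‖
  deriv_eigenvalue : ∀ s ∈ Icc (0 : ℝ) 1, ∀ m, ‖derivWithin (lam m) (Icc 0 1) s‖ ≤ M
  deriv_two_projector : ∀ s ∈ Icc (0 : ℝ) 1, ∀ m,
    ‖iteratedDerivWithin 2 (eigenProjector F lam m) (Icc 0 1) s‖ ≤ M
  norm_inner : ∀ s ∈ Icc (0 : ℝ) 1, ‖innerPart F s‖ ≤ q
  norm_inner_pow : ∀ s ∈ Icc (0 : ℝ) 1, ‖innerPart F s ^ N‖ ≤ r ^ N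
  modulus_inner : ∀ s ∈ Icc (0 : ℝ) 1, ∀ t ∈ Icc (0 : ℝ) 1,
    ‖innerPart F s - innerPart F t‖ ≤ ω |s - t|

end DiscreteAdiabatic

end

/-!
The proof has a spectral part and a quantitative part.

*Spectral part.* Semisimplicity makes the functional calculus elementary: if `A B = ν B`, then the
resolvent of `A` acts on `B` as the scalar `(z - ν)⁻¹`, so that a contour integral of the resolvent
fixes or annihilates `B` according to the position of `ν`. Hence the spectral projectors at the
peripheral eigenvalues are idempotent, mutually orthogonal and different from `0`, and the resolvent
of the peripheral part `G = F P` is an explicit sum over eigenvalues. Over a fixed circle the contour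
integral is a smooth function of the operator (`contDiffAt_contourProjector`), so applied to the
`C²` family `G` it gives a `C²` family. As it is continuous and not `0`, peripheral eigenvalues
persist, and as their number is constant they can be followed continuously
(`Admissible.exists_labelling`); as it equals a single spectral projector near a given parameter, the
projectors and then the eigenvalues are `C²`.

*Adiabatic part.* With the generator `K = ∑ Pᵢ' Pᵢ` one has `[K, Pⱼ] = Pⱼ'`, so that
`Pⱼ W` and `W Pⱼ(0)` solve the same linear equation and agree. The functions `Yᵐ = W Pᵐ(0)` thus
satisfy `Yᵐ = Pᵐ Yᵐ` and `(Yᵐ)' = Pᵐ' Yᵐ`. With `h = 1 / T`, the function `∏ λᵐ • Yᵐ` fails to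
follow the discrete evolution by terms of size `h` in each step. The part of these terms in the other
peripheral eigenspaces oscillates, and is removed up to `O(h²)` by a first order correction `h Xᵐ`
that involves the inverse gaps `(λᵐ - λʲ)⁻¹` (`corrector`, `AdiabaticData.mul_deriv_add_corrector`).
The part in the range of `Q` is not corrected, as `F Q` is only continuous in the parameter; it is
summable because the evolution contracts there. The lemma `AdiabaticData.stability` turns this into
an error of size `h`: the components of a perturbed evolution in the peripheral eigenspaces have
constant norm up to the variation of the projectors, the component in the range of `Q` is damped, and
a discrete Grönwall inequality combines them.

Products of `F^Q` decay because `F^Q` is nearly constant over a block of `N` steps, on which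
`‖F^Q(s)^N‖ ≤ r^N`. All data enter through one bound `B`, which depends continuously on `C_P`; the
number of eigenvalues is bounded in terms of their separation on the unit circle. For a single family
the quantitative data exist by compactness of `[0,1]` and Gelfand's formula (`exists_hasBounds`).
-/

/-! ### Contour integrals of the resolvent -/

section Contour

variable {𝔸 : Type*} [NormedRing 𝔸] [NormedAlgebra ℂ 𝔸]

namespace DiscreteAdiabatic

lemma commute_resolvent (a : 𝔸) (z : ℂ) : Commute a (resolvent a z) := by
  have h : Commute a (algebraMap ℂ 𝔸 z - a) :=
    Commute.sub_right (Algebra.commute_algebraMap_right z a) (Commute.refl a)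
  rw [resolvent]
  by_cases hu : IsUnit (algebraMap ℂ 𝔸 z - a)
  · obtain ⟨u, hu⟩ := hu
    rw [← hu] at h ⊢
    rw [Ring.inverse_unit]
    exact h.units_inv_right
  · rw [Ring.inverse_non_unit _ hu]
    exact Commute.zero_right a

lemma resolvent_mul_of_mul_eq_smul {a b : 𝔸} {ν z : ℂ} (hb : a * b = ν • b)
    (hz : z ∈ resolventSet ℂ a) (hne : z ≠ ν) : resolvent a z * b = (z - ν)⁻¹ • b := by
  have h1 : (algebraMap ℂ 𝔸 z - a) * b = (z - ν) • b := by
    rw [sub_mul, hb, sub_smul, Algebra.algebraMap_eq_smul_one, smul_mul_assoc, one_mul]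
  have h2 : resolvent a z * ((algebraMap ℂ 𝔸 z - a) * b) = b := by
    rw [← mul_assoc, resolvent, Ring.inverse_mul_cancel _ hz, one_mul]
  rw [h1, mul_smul_comm] at h2
  rw [eq_inv_smul_iff₀ (sub_ne_zero.2 hne)]
  exact h2

variable [CompleteSpace 𝔸]

/-- The contour integral `(2πi)⁻¹ ∮ (z - a)⁻¹ dz` over the circle with centre `c` and radius `R`.
It is meaningful when the circle lies in the resolvent set of `a`. -/
noncomputable def contourProjector (a : 𝔸) (c : ℂ) (R : ℝ) : 𝔸 :=
  (2 * (Real.pi : ℂ) * Complex.I)⁻¹ • ∮ z in C(c, R), resolvent a z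

lemma continuousOn_resolvent {a : 𝔸} {s : Set ℂ} (hs : s ⊆ resolventSet ℂ a) :
    ContinuousOn (resolvent a) s := fun _ hz =>
  (spectrum.hasDerivAt_resolvent_const_left (hs hz)).continuousAt.continuousWithinAt

lemma circleIntegral_clm_comp {E F : Type*} [NormedAddCommGroup E] [NormedSpace ℂ E]
    [CompleteSpace E] [NormedAddCommGroup F] [NormedSpace ℂ F] [CompleteSpace F]
    (L : E →L[ℂ] F) {f : ℂ → E} {c : ℂ} {R : ℝ} (hf : CircleIntegrable f c R) :
    ∮ z in C(c, R), L (f z) = L (∮ z in C(c, R), f z) := by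
  rw [circleIntegral, circleIntegral, ← L.intervalIntegral_comp_comm hf.out]
  simp only [map_smul]

lemma contourProjector_mul {a : 𝔸} {c : ℂ} {R : ℝ} (hR : 0 ≤ R)
    (h : Metric.sphere c R ⊆ resolventSet ℂ a) (b : 𝔸) :
    contourProjector a c R * b =
      (2 * (Real.pi : ℂ) * Complex.I)⁻¹ • ∮ z in C(c, R), resolvent a z * b := by
  rw [contourProjector, smul_mul_assoc]
  congr 1
  exact (circleIntegral_clm_comp ((ContinuousLinearMap.mul ℂ 𝔸).flip b)
    ((continuousOn_resolvent h).circleIntegrable hR)).symm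

lemma mul_contourProjector {a : 𝔸} {c : ℂ} {R : ℝ} (hR : 0 ≤ R)
    (h : Metric.sphere c R ⊆ resolventSet ℂ a) (b : 𝔸) :
    b * contourProjector a c R =
      (2 * (Real.pi : ℂ) * Complex.I)⁻¹ • ∮ z in C(c, R), b * resolvent a z := by
  rw [contourProjector, mul_smul_comm]
  congr 1
  exact (circleIntegral_clm_comp (ContinuousLinearMap.mul ℂ 𝔸 b)
    ((continuousOn_resolvent h).circleIntegrable hR)).symm

lemma commute_contourProjector {a : 𝔸} {c : ℂ} {R : ℝ} (hR : 0 ≤ R)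
    (h : Metric.sphere c R ⊆ resolventSet ℂ a) : Commute a (contourProjector a c R) := by
  rw [Commute, SemiconjBy, contourProjector_mul hR h, mul_contourProjector hR h]
  simp only [(commute_resolvent a _).eq]

lemma circleIntegral_sub_inv_eq_zero {c w : ℂ} {R : ℝ} (hR : 0 ≤ R)
    (hw : w ∉ Metric.closedBall c R) : ∮ z in C(c, R), (z - w)⁻¹ = 0 := by
  have hne : ∀ z ∈ Metric.closedBall c R, z - w ≠ 0 := fun z hz h0 =>
    hw (by rwa [← sub_eq_zero.1 h0])
  refine Complex.circleIntegral_eq_zero_of_differentiable_on_off_countable hR countable_empty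
    ((continuousOn_id.sub continuousOn_const).inv₀ hne) fun z hz => ?_
  exact (differentiableAt_id.sub_const w).inv (hne z (Metric.ball_subset_closedBall hz.1))

/-- If `a * b = ν • b` with `ν` inside the circle, then the contour projector fixes `b`. -/
lemma contourProjector_mul_of_mem_ball {a b : 𝔸} {c ν : ℂ} {R : ℝ}
    (h : Metric.sphere c R ⊆ resolventSet ℂ a) (hb : a * b = ν • b)
    (hν : ν ∈ Metric.ball c R) : contourProjector a c R * b = b := by
  have hR : 0 ≤ R := (Metric.pos_of_mem_ball hν).le
  rw [contourProjector_mul hR h, circleIntegral.integral_congr hR (g := fun z => (z - ν)⁻¹ • b),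
    circleIntegral.integral_smul_const, circleIntegral.integral_sub_inv_of_mem_ball hν,
    inv_smul_smul₀ (by simp [Real.pi_ne_zero])]
  intro z hz
  refine resolvent_mul_of_mul_eq_smul hb (h hz) ?_
  rintro rfl
  exact (Metric.mem_ball.1 hν).ne (Metric.mem_sphere.1 hz)

/-- If `a * b = ν • b` with `ν` outside the circle, then the contour projector annihilates `b`. -/
lemma contourProjector_mul_of_notMem_closedBall {a b : 𝔸} {c ν : ℂ} {R : ℝ} (hR : 0 ≤ R)
    (h : Metric.sphere c R ⊆ resolventSet ℂ a) (hb : a * b = ν • b)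
    (hν : ν ∉ Metric.closedBall c R) : contourProjector a c R * b = 0 := by
  rw [contourProjector_mul hR h, circleIntegral.integral_congr hR (g := fun z => (z - ν)⁻¹ • b),
    circleIntegral.integral_smul_const, circleIntegral_sub_inv_eq_zero hR hν, zero_smul, smul_zero]
  intro z hz
  refine resolvent_mul_of_mul_eq_smul hb (h hz) ?_
  rintro rfl
  exact hν (Metric.sphere_subset_closedBall hz)

/-- Integration over a circle, as a continuous linear map on functions of the angle. -/
noncomputable def circleIntegralCLM (c : ℂ) (R : ℝ) : C(Icc 0 (2 * Real.pi), 𝔸) →L[ℝ] 𝔸 :=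
  LinearMap.mkContinuous
    { toFun := fun g => ∫ θ in (0 : ℝ)..2 * Real.pi,
        deriv (circleMap c R) θ • IccExtend Real.two_pi_pos.le g θ
      map_add' := fun f g => by
        rw [← intervalIntegral.integral_add]
        · refine intervalIntegral.integral_congr fun θ _ => ?_
          simp [IccExtend]
        all_goals
          refine Continuous.intervalIntegrable ?_ _ _
          simp only [deriv_circleMap]
          exact (((continuous_circleMap 0 R).mul continuous_const)).smul
            (Continuous.Icc_extend' (map_continuous _))
      map_smul' := fun r g => by
        rw [RingHom.id_apply, ← intervalIntegral.integral_smul]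
        refine intervalIntegral.integral_congr fun θ _ => ?_
        simp [IccExtend, smul_comm r] }
    (|R| * |2 * Real.pi - 0|) fun g => by
      rw [mul_right_comm]
      refine intervalIntegral.norm_integral_le_of_norm_le_const fun θ _ => ?_
      rw [norm_smul]
      refine mul_le_mul ?_ (g.norm_coe_le_norm _) (norm_nonneg _) (abs_nonneg _)
      simp [deriv_circleMap]

/-- The contour projector is a smooth function of the element of the algebra. The resolvents
along the circle form an element of the Banach algebra of continuous functions of the angle, and
inversion is smooth there. -/
lemma contDiffAt_contourProjector {a : 𝔸} {c : ℂ} {R : ℝ} (hR : 0 ≤ R)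
    (h : Metric.sphere c R ⊆ resolventSet ℂ a) {n : WithTop ℕ∞} :
    ContDiffAt ℝ n (fun b : 𝔸 => contourProjector b c R) a := by
  let Φ : C(Icc 0 (2 * Real.pi), 𝔸) := ⟨fun θ => algebraMap ℂ 𝔸 (circleMap c R θ), by fun_prop⟩
  let κ : 𝔸 →L[ℝ] C(Icc 0 (2 * Real.pi), 𝔸) := LinearMap.mkContinuous
    { toFun := fun b => ContinuousMap.const _ b
      map_add' := fun _ _ => rfl
      map_smul' := fun _ _ => rfl } 1 fun b => by
        rw [one_mul]
        exact (ContinuousMap.norm_le _ (norm_nonneg b)).2 fun _ => le_rfl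
  have hmem : ∀ θ : ℝ, circleMap c R θ ∈ resolventSet ℂ a := fun θ => h (circleMap_mem_sphere c hR θ)
  have hres : Continuous fun θ : Icc 0 (2 * Real.pi) => resolvent a (circleMap c R θ) :=
    (continuousOn_resolvent h).comp_continuous (by fun_prop) fun θ => circleMap_mem_sphere c hR θ
  let U : (C(Icc 0 (2 * Real.pi), 𝔸))ˣ :=
    { val := Φ - κ a
      inv := ⟨_, hres⟩
      val_inv := by
        ext θ
        exact Ring.mul_inverse_cancel _ (hmem θ)
      inv_val := by
        ext θ
        exact Ring.inverse_mul_cancel _ (hmem θ) }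
  have hinv : ContDiffAt ℝ n Ring.inverse (Φ - κ a) := contDiffAt_ringInverse ℝ U
  have hcomp : ContDiffAt ℝ n (fun b => (2 * (Real.pi : ℂ) * Complex.I)⁻¹ •
      circleIntegralCLM c R (Ring.inverse (Φ - κ b))) a :=
    (((circleIntegralCLM c R).contDiff.contDiffAt).comp a
      (hinv.comp a (contDiffAt_const.sub κ.contDiff.contDiffAt))).const_smul _
  refine hcomp.congr_of_eventuallyEq ?_
  have hunit : ∀ᶠ b in 𝓝 a, IsUnit (Φ - κ b) :=
    (by fun_prop : ContinuousAt (fun b => Φ - κ b) a).eventually (Units.isOpen.mem_nhds U.isUnit)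
  filter_upwards [hunit] with b hb
  obtain ⟨V, hV⟩ := hb
  rw [contourProjector, circleIntegral]
  congr 1
  refine intervalIntegral.integral_congr fun θ hθ => ?_
  rw [uIcc_of_le Real.two_pi_pos.le] at hθ
  rw [IccExtend_of_mem _ _ hθ, ← hV, Ring.inverse_unit]
  congr 1
  have h1 : (V : C(Icc 0 (2 * Real.pi), 𝔸)) ⟨θ, hθ⟩ = algebraMap ℂ 𝔸 (circleMap c R θ) - b := by
    rw [hV]; rfl
  have h2 : (V : C(Icc 0 (2 * Real.pi), 𝔸)) ⟨θ, hθ⟩ * (V⁻¹).val ⟨θ, hθ⟩ = 1 :=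
    congrArg (fun g : C(Icc 0 (2 * Real.pi), 𝔸) => g ⟨θ, hθ⟩) V.mul_inv
  have h3 : (V⁻¹).val ⟨θ, hθ⟩ * (V : C(Icc 0 (2 * Real.pi), 𝔸)) ⟨θ, hθ⟩ = 1 :=
    congrArg (fun g : C(Icc 0 (2 * Real.pi), 𝔸) => g ⟨θ, hθ⟩) V.inv_mul
  rw [resolvent, ← h1]
  exact Ring.inverse_unit ⟨_, _, h2, h3⟩

end DiscreteAdiabatic

end Contour

/-! ### Spectral projectors at semisimple peripheral eigenvalues -/

namespace DiscreteAdiabatic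

section Pointwise

variable {X : Type u} [NormedAddCommGroup X] [NormedSpace ℂ X]

lemma sphere_subset_resolventSet_of_isolated {A : X →L[ℂ] X} {μ : ℂ} {r : ℝ} (hr : 0 < r)
    (h : spectrum ℂ A ∩ Metric.closedBall μ r ⊆ {μ}) :
    Metric.sphere μ r ⊆ resolventSet ℂ A := by
  intro z hz
  by_contra hzs
  have : z = μ := h ⟨hzs, Metric.sphere_subset_closedBall hz⟩
  subst this
  simp [hr.ne] at hz

lemma exists_spectralProjector_eq {A : X →L[ℂ] X} {μ : ℂ} (h : IsIsolatedInSpectrum A μ) :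
    ∃ r : ℝ, 0 < r ∧ spectrum ℂ A ∩ Metric.closedBall μ r ⊆ {μ} ∧
      spectralProjector A μ = contourProjector A μ r := by
  classical
  refine ⟨h.2.choose, h.2.choose_spec.1, h.2.choose_spec.2, ?_⟩
  rw [spectralProjector, dif_pos h, contourProjector]

/-- The operators in an admissible family: the spectral radius is `1`, and the peripheral spectrum
consists of finitely many isolated semisimple eigenvalues. -/
structure IsPeripherallySemisimple (A : X →L[ℂ] X) : Prop where
  spectralRadius_eq_one : spectralRadius ℂ A = 1
  finite : (peripheralSpectrum A).Finite
  semisimple : ∀ μ ∈ peripheralSpectrum A, IsIsolatedSemisimpleEigenvalue A μ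

lemma IsPeripherallySemisimple.mul_projector {A : X →L[ℂ] X}
    (hA : IsPeripherallySemisimple A) {μ : ℂ} (hμ : μ ∈ peripheralSpectrum A) :
    A * spectralProjector A μ = μ • spectralProjector A μ := (hA.semisimple μ hμ).2.2

lemma IsPeripherallySemisimple.peripheralProjector_eq_sum {A : X →L[ℂ] X}
    (hA : IsPeripherallySemisimple A) :
    peripheralProjector A = ∑ μ ∈ hA.finite.toFinset, spectralProjector A μ := by
  rw [peripheralProjector, finsum_mem_eq_finite_toFinset_sum _ hA.finite]

lemma IsPeripherallySemisimple.norm_eq_one {A : X →L[ℂ] X}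
    (hA : IsPeripherallySemisimple A) {μ : ℂ} (hμ : μ ∈ peripheralSpectrum A) : ‖μ‖ = 1 := by
  have h := hμ.2
  rwa [hA.spectralRadius_eq_one, ENNReal.ofReal_eq_one] at h

variable [CompleteSpace X]

lemma commute_spectralProjector (A : X →L[ℂ] X) (μ : ℂ) : Commute A (spectralProjector A μ) := by
  by_cases h : IsIsolatedInSpectrum A μ
  · obtain ⟨r, hr, hs, he⟩ := exists_spectralProjector_eq h
    rw [he]
    exact commute_contourProjector hr.le (sphere_subset_resolventSet_of_isolated hr hs)
  · rw [spectralProjector, dif_neg h]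
    exact Commute.zero_right A

lemma spectralProjector_mul_of_mul_eq {A B : X →L[ℂ] X} {μ : ℂ} (h : IsIsolatedInSpectrum A μ)
    (hB : A * B = μ • B) : spectralProjector A μ * B = B := by
  obtain ⟨r, hr, hs, he⟩ := exists_spectralProjector_eq h
  rw [he]
  exact contourProjector_mul_of_mem_ball (sphere_subset_resolventSet_of_isolated hr hs) hB
    (Metric.mem_ball_self hr)

lemma spectralProjector_mul_of_mul_eq_of_ne {A B : X →L[ℂ] X} {μ ν : ℂ}
    (h : IsIsolatedInSpectrum A μ) (hν : ν ∈ spectrum ℂ A) (hne : ν ≠ μ)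
    (hB : A * B = ν • B) : spectralProjector A μ * B = 0 := by
  obtain ⟨r, hr, hs, he⟩ := exists_spectralProjector_eq h
  rw [he]
  exact contourProjector_mul_of_notMem_closedBall hr.le
    (sphere_subset_resolventSet_of_isolated hr hs) hB fun hmem => hne (hs ⟨hν, hmem⟩)

/-- The spectral projector at an eigenvalue does not vanish: it fixes the rank one operators whose
range is spanned by an eigenvector. -/
lemma spectralProjector_ne_zero {A : X →L[ℂ] X} {μ : ℂ} (h : IsIsolatedInSpectrum A μ)
    (he : Module.End.HasEigenvalue (A : X →ₗ[ℂ] X) μ) : spectralProjector A μ ≠ 0 := by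
  obtain ⟨v, hv⟩ := he.exists_hasEigenvector
  have hAv : A v = μ • v := hv.apply_eq_smul
  obtain ⟨f, -, hf⟩ := exists_dual_vector ℂ v (norm_ne_zero_iff.2 hv.2)
  have hfv : f v ≠ 0 := by
    rw [hf]
    simpa using hv.2
  intro h0
  have h1 : A * (f.smulRight v) = μ • f.smulRight v := by
    ext x
    simp [hAv, smul_comm μ]
  have h2 := spectralProjector_mul_of_mul_eq h h1
  rw [h0, zero_mul] at h2
  have h3 := congrArg (fun B : X →L[ℂ] X => B v) h2
  exact smul_ne_zero hfv hv.2 (by simpa using h3.symm)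

namespace IsPeripherallySemisimple

variable {A : X →L[ℂ] X} (hA : IsPeripherallySemisimple A)
include hA

lemma projector_mul {μ : ℂ} (hμ : μ ∈ peripheralSpectrum A) :
    spectralProjector A μ * A = μ • spectralProjector A μ := by
  rw [← (commute_spectralProjector A μ).eq, hA.mul_projector hμ]

lemma projector_mul_self {μ : ℂ} (hμ : μ ∈ peripheralSpectrum A) :
    spectralProjector A μ * spectralProjector A μ = spectralProjector A μ :=
  spectralProjector_mul_of_mul_eq (hA.semisimple μ hμ).1 (hA.mul_projector hμ)

lemma projector_mul_of_ne {μ ν : ℂ} (hμ : μ ∈ peripheralSpectrum A)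
    (hν : ν ∈ peripheralSpectrum A) (hne : μ ≠ ν) :
    spectralProjector A μ * spectralProjector A ν = 0 :=
  spectralProjector_mul_of_mul_eq_of_ne (hA.semisimple μ hμ).1 hν.1 hne.symm (hA.mul_projector hν)

lemma projector_ne_zero {μ : ℂ} (hμ : μ ∈ peripheralSpectrum A) : spectralProjector A μ ≠ 0 :=
  spectralProjector_ne_zero (hA.semisimple μ hμ).1 (hA.semisimple μ hμ).2.1

lemma peripheralProjector_mul {μ : ℂ} (hμ : μ ∈ peripheralSpectrum A) :
    peripheralProjector A * spectralProjector A μ = spectralProjector A μ := by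
  rw [hA.peripheralProjector_eq_sum, Finset.sum_mul, Finset.sum_eq_single μ]
  · exact hA.projector_mul_self hμ
  · intro ν hν hne
    exact hA.projector_mul_of_ne (by simpa using hν) hμ hne
  · intro h
    simp [hμ] at h

lemma peripheralProjector_mul_self :
    peripheralProjector A * peripheralProjector A = peripheralProjector A := by
  conv_lhs => rw [hA.peripheralProjector_eq_sum, ← hA.peripheralProjector_eq_sum]
  conv_lhs => arg 2; rw [hA.peripheralProjector_eq_sum]
  rw [Finset.mul_sum, hA.peripheralProjector_eq_sum]
  refine Finset.sum_congr rfl fun μ hμ => ?_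
  rw [← hA.peripheralProjector_eq_sum]
  exact hA.peripheralProjector_mul (by simpa using hμ)

lemma commute_peripheralProjector : Commute A (peripheralProjector A) := by
  rw [hA.peripheralProjector_eq_sum]
  exact Commute.sum_right _ _ _ fun μ _ => commute_spectralProjector A μ

/-- The peripheral part `A P` acts as `A` on the ranges of the spectral projectors. -/
lemma peripheralPart_mul_projector {μ : ℂ} (hμ : μ ∈ peripheralSpectrum A) :
    A * peripheralProjector A * spectralProjector A μ = μ • spectralProjector A μ := by
  rw [mul_assoc, hA.peripheralProjector_mul hμ, hA.mul_projector hμ]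

lemma peripheralPart_mul_complProjector :
    A * peripheralProjector A * complProjector A = (0 : ℂ) • complProjector A := by
  rw [complProjector, mul_sub, mul_one, mul_assoc, hA.peripheralProjector_mul_self, sub_self,
    zero_smul]

lemma notMem_resolventSet_peripheralPart {μ : ℂ} (hμ : μ ∈ peripheralSpectrum A) :
    μ ∉ resolventSet ℂ (A * peripheralProjector A) := by
  intro h
  apply hA.projector_ne_zero hμ
  have h1 : (algebraMap ℂ (X →L[ℂ] X) μ - A * peripheralProjector A) * spectralProjector A μ = 0 := by
    rw [sub_mul, hA.peripheralPart_mul_projector hμ, Algebra.algebraMap_eq_smul_one,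
      smul_mul_assoc, one_mul, sub_self]
  exact (IsUnit.mul_right_eq_zero h).1 h1

lemma mem_resolventSet_peripheralPart {z : ℂ} (h0 : z ≠ 0) (hz : z ∉ peripheralSpectrum A) :
    z ∈ resolventSet ℂ (A * peripheralProjector A) := by
  set G := A * peripheralProjector A with hG
  set B := ∑ μ ∈ hA.finite.toFinset, (z - μ)⁻¹ • spectralProjector A μ +
    z⁻¹ • complProjector A with hB
  have hPG : Commute G (peripheralProjector A) :=
    Commute.mul_left hA.commute_peripheralProjector (Commute.refl _)
  have hcomm : Commute G B := by
    refine Commute.add_right (Commute.sum_right _ _ _ fun μ hμ => ?_) ?_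
    · refine Commute.smul_right ?_ _
      have hμ' : μ ∈ peripheralSpectrum A := by simpa using hμ
      refine Commute.mul_left (commute_spectralProjector A μ) ?_
      rw [hA.peripheralProjector_eq_sum]
      refine Commute.sum_left _ _ _ fun ν hν => ?_
      have hν' : ν ∈ peripheralSpectrum A := by simpa using hν
      by_cases hne : μ = ν
      · exact hne ▸ Commute.refl _
      · rw [Commute, SemiconjBy, hA.projector_mul_of_ne hμ' hν' hne,
          hA.projector_mul_of_ne hν' hμ' (Ne.symm hne)]
    · exact Commute.smul_right ((Commute.one_right G).sub_right hPG) _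
  have h1 : (algebraMap ℂ (X →L[ℂ] X) z - G) * B = 1 := by
    have hterm : ∀ μ ∈ hA.finite.toFinset,
        (algebraMap ℂ (X →L[ℂ] X) z - G) * ((z - μ)⁻¹ • spectralProjector A μ) =
          spectralProjector A μ := by
      intro μ hμ
      have hμ' : μ ∈ peripheralSpectrum A := by simpa using hμ
      have hne : z - μ ≠ 0 := fun h => hz (by rwa [sub_eq_zero.1 h])
      rw [mul_smul_comm, sub_mul, hA.peripheralPart_mul_projector hμ',
        Algebra.algebraMap_eq_smul_one, smul_mul_assoc, one_mul, ← sub_smul, inv_smul_smul₀ hne]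
    have hQ : (algebraMap ℂ (X →L[ℂ] X) z - G) * (z⁻¹ • complProjector A) = complProjector A := by
      rw [mul_smul_comm, sub_mul, hA.peripheralPart_mul_complProjector,
        Algebra.algebraMap_eq_smul_one, smul_mul_assoc, one_mul, zero_smul, sub_zero,
        inv_smul_smul₀ h0]
    rw [hB, mul_add, hQ, Finset.mul_sum, Finset.sum_congr rfl hterm,
      ← hA.peripheralProjector_eq_sum, complProjector, add_sub_cancel]
  have h2 : B * (algebraMap ℂ (X →L[ℂ] X) z - G) = 1 := by
    rw [← h1]
    exact ((Algebra.commute_algebraMap_right z B).sub_right hcomm.symm).eq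
  exact ⟨⟨_, B, h1, h2⟩, rfl⟩

/-- A contour integral of the resolvent of the peripheral part `A P`, over a circle that does not
enclose `0`, is the sum of the spectral projectors at the enclosed peripheral eigenvalues. -/
lemma contourProjector_peripheralPart {c : ℂ} {R : ℝ} (hR : 0 ≤ R)
    (h : Metric.sphere c R ⊆ resolventSet ℂ (A * peripheralProjector A))
    (h0 : (0 : ℂ) ∉ Metric.closedBall c R) :
    contourProjector (A * peripheralProjector A) c R =
      ∑ μ ∈ hA.finite.toFinset with dist μ c < R, spectralProjector A μ := by
  set G := A * peripheralProjector A with hG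
  have h1 : contourProjector G c R = contourProjector G c R *
      (∑ μ ∈ hA.finite.toFinset, spectralProjector A μ + complProjector A) := by
    rw [← hA.peripheralProjector_eq_sum, complProjector, add_sub_cancel, mul_one]
  rw [h1, mul_add, contourProjector_mul_of_notMem_closedBall hR h
    hA.peripheralPart_mul_complProjector h0, add_zero, Finset.mul_sum, Finset.sum_filter]
  refine Finset.sum_congr rfl fun μ hμ => ?_
  have hμ' : μ ∈ peripheralSpectrum A := by simpa using hμ
  split_ifs with hd
  · exact contourProjector_mul_of_mem_ball h (hA.peripheralPart_mul_projector hμ') hd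
  · refine contourProjector_mul_of_notMem_closedBall hR h (hA.peripheralPart_mul_projector hμ') ?_
    intro hmem
    have : μ ∈ Metric.sphere c R := le_antisymm hmem (not_lt.1 hd)
    exact hA.notMem_resolventSet_peripheralPart hμ' (h this)

/-- Small circles about a peripheral eigenvalue are admissible contours. -/
lemma exists_contour {μ : ℂ} (hμ : μ ∈ peripheralSpectrum A) {ε : ℝ} (hε : 0 < ε) :
    ∃ R, 0 < R ∧ R ≤ ε ∧ (0 : ℂ) ∉ Metric.closedBall μ R ∧
      (∀ ν ∈ peripheralSpectrum A, ν ≠ μ → ν ∉ Metric.closedBall μ R) ∧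
      Metric.sphere μ R ⊆ resolventSet ℂ (A * peripheralProjector A) := by
  obtain ⟨r, hr, hs⟩ := (hA.semisimple μ hμ).1.2
  have hR : 0 < min (min r ε) (1 / 2) := by positivity
  have h0 : (0 : ℂ) ∉ Metric.closedBall μ (min (min r ε) (1 / 2)) := by
    intro h
    rw [Metric.mem_closedBall, dist_zero_left, hA.norm_eq_one hμ] at h
    have := h.trans (min_le_right _ _)
    norm_num at this
  have hother : ∀ ν ∈ peripheralSpectrum A, ν ≠ μ →
      ν ∉ Metric.closedBall μ (min (min r ε) (1 / 2)) := by
    intro ν hν hne hmem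
    exact hne (hs ⟨hν.1, Metric.closedBall_subset_closedBall
      ((min_le_left _ _).trans (min_le_left _ _)) hmem⟩)
  refine ⟨_, hR, (min_le_left _ _).trans (min_le_right _ _), h0, hother, fun z hz => ?_⟩
  refine hA.mem_resolventSet_peripheralPart ?_ fun hzp => ?_
  · rintro rfl
    exact h0 (Metric.sphere_subset_closedBall hz)
  · by_cases hne : z = μ
    · rw [hne, Metric.mem_sphere, dist_self] at hz
      exact hR.ne hz
    · exact hother z hzp hne (Metric.sphere_subset_closedBall hz)

end IsPeripherallySemisimple

lemma eventually_sphere_subset_resolventSet {A : X →L[ℂ] X} {c : ℂ} {R : ℝ}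
    (h : Metric.sphere c R ⊆ resolventSet ℂ A) :
    ∀ᶠ B in 𝓝 A, Metric.sphere c R ⊆ resolventSet ℂ B := by
  refine (isCompact_sphere c R).eventually_forall_of_forall_eventually
    (P := fun B z => z ∈ resolventSet ℂ B) fun z hz => ?_
  have hcont : Continuous fun p : (X →L[ℂ] X) × ℂ => algebraMap ℂ (X →L[ℂ] X) p.2 - p.1 := by
    fun_prop
  exact (Units.isOpen.preimage hcont).mem_nhds (x := (A, z)) (h hz)

end Pointwise

end DiscreteAdiabatic

/-! ### Continuous labellings and smoothness of the spectral data -/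

namespace DiscreteAdiabatic

/-- A transitive relation between the points of `[0,1]` which holds for all pairs of sufficiently
near points holds for the pair `0`, `1`. -/
lemma relation_zero_one_of_local {R : ℝ → ℝ → Prop}
    (htrans : ∀ a b c, a ∈ Icc (0 : ℝ) 1 → c ∈ Icc (0 : ℝ) 1 → a ≤ b → b ≤ c →
      R a b → R b c → R a c)
    (hloc : ∀ s ∈ Icc (0 : ℝ) 1, ∃ r > 0, ∀ a ∈ Icc (0 : ℝ) 1, ∀ b ∈ Icc (0 : ℝ) 1, a ≤ b →
      dist a s < r → dist b s < r → R a b) : R 0 1 := by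
  choose! r hr hR using hloc
  obtain ⟨t, ht0, hmono, ⟨n, hn⟩, hsub⟩ := exists_monotone_Icc_subset_open_cover_Icc
    (zero_le_one' ℝ) (c := fun s : Icc (0 : ℝ) 1 => Metric.ball s (r s))
    (fun s => Metric.isOpen_ball) fun s _ => mem_iUnion.2 ⟨s, Metric.mem_ball_self (hr s s.2)⟩
  have hstep : ∀ k, R (t k) (t (k + 1)) := fun k => by
    obtain ⟨i, hi⟩ := hsub k
    have hle := hmono (Nat.le_succ k)
    exact hR i i.2 _ (t k).2 _ (t (k + 1)).2 hle (hi ⟨le_rfl, hle⟩) (hi ⟨hle, le_rfl⟩)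
  have hall : ∀ k, R (t 0) (t (k + 1)) := fun k => by
    induction k with
    | zero => exact hstep 0
    | succ k ih =>
      exact htrans _ _ _ (t 0).2 (t (k + 1 + 1)).2 (hmono (Nat.zero_le _)) (hmono (Nat.le_succ _))
        ih (hstep _)
  have := hall n
  rwa [ht0, hn (n + 1) (Nat.le_succ n)] at this

lemma continuousOn_Icc_union {E : Type*} [TopologicalSpace E] {f g : ℝ → E} {a b c : ℝ}
    (hab : a ≤ b) (hbc : b ≤ c) (hf : ContinuousOn f (Icc a b)) (hg : ContinuousOn g (Icc b c))
    (h : f b = g b) : ContinuousOn (fun s => if s ≤ b then f s else g s) (Icc a c) := by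
  rw [← Icc_union_Icc_eq_Icc hab hbc]
  refine ContinuousOn.union_of_isClosed ?_ ?_ isClosed_Icc isClosed_Icc
  · exact hf.congr fun s hs => if_pos hs.2
  · refine hg.congr fun s hs => ?_
    by_cases hsb : s ≤ b
    · simp only [le_antisymm hsb hs.1, le_refl, if_true, h]
    · simp only [if_neg hsb]

section Family

variable {X : Type u} [NormedAddCommGroup X] [NormedSpace ℂ X] {F : ℝ → X →L[ℂ] X}

lemma Admissible.isPeripherallySemisimple (hF : Admissible F) {s : ℝ} (hs : s ∈ Icc (0 : ℝ) 1) :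
    IsPeripherallySemisimple (F s) :=
  ⟨hF.spectralRadius_eq_one s hs, hF.finite_peripheral s hs, hF.semisimple s hs⟩

/-- A continuous labelling of the peripheral eigenvalues for parameters in the set `S`. -/
structure IsLabellingOn (F : ℝ → X →L[ℂ] X) (S : Set ℝ) {z : ℕ} (lam : Fin z → ℝ → ℂ) : Prop where
  continuousOn : ∀ m, ContinuousOn (lam m) S
  injective : ∀ s ∈ S, Function.Injective (fun m => lam m s)
  range_eq : ∀ s ∈ S, range (fun m => lam m s) = peripheralSpectrum (F s)

lemma IsLabellingOn.mono {S S' : Set ℝ} {z : ℕ} {lam : Fin z → ℝ → ℂ}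
    (h : IsLabellingOn F S lam) (hS : S' ⊆ S) : IsLabellingOn F S' lam :=
  ⟨fun m => (h.continuousOn m).mono hS, fun s hs => h.injective s (hS hs),
    fun s hs => h.range_eq s (hS hs)⟩

lemma exists_isLabellingOn_trans {z : ℕ} {a b c : ℝ} (hab : a ≤ b) (hbc : b ≤ c)
    (h₁ : ∃ lam : Fin z → ℝ → ℂ, IsLabellingOn F (Icc a b) lam)
    (h₂ : ∃ lam : Fin z → ℝ → ℂ, IsLabellingOn F (Icc b c) lam) :
    ∃ lam : Fin z → ℝ → ℂ, IsLabellingOn F (Icc a c) lam := by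
  obtain ⟨f, hf⟩ := h₁
  obtain ⟨g, hg⟩ := h₂
  have hb₁ : b ∈ Icc a b := ⟨hab, le_rfl⟩
  have hb₂ : b ∈ Icc b c := ⟨le_rfl, hbc⟩
  have hr : range (fun m => f m b) = range (fun m => g m b) :=
    (hf.range_eq b hb₁).trans (hg.range_eq b hb₂).symm
  -- the permutation of the labels that makes the two labellings agree at `b`
  let σ : Fin z ≃ Fin z := (Equiv.ofInjective _ (hf.injective b hb₁)).trans
    ((Equiv.setCongr hr).trans (Equiv.ofInjective _ (hg.injective b hb₂)).symm)
  have hσ : ∀ m, g (σ m) b = f m b := fun m =>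
    congrArg Subtype.val (Equiv.apply_symm_apply (Equiv.ofInjective _ (hg.injective b hb₂))
      (Equiv.setCongr hr (Equiv.ofInjective _ (hf.injective b hb₁) m)))
  refine ⟨fun m s => if s ≤ b then f m s else g (σ m) s, fun m => ?_, fun s hs => ?_,
    fun s hs => ?_⟩
  · exact continuousOn_Icc_union hab hbc (hf.continuousOn m) (hg.continuousOn _) (hσ m).symm
  · by_cases hsb : s ≤ b
    · simpa only [if_pos hsb] using hf.injective s ⟨hs.1, hsb⟩
    · simp only [if_neg hsb]
      exact (hg.injective s ⟨(not_le.1 hsb).le, hs.2⟩).comp σ.injective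
  · by_cases hsb : s ≤ b
    · simpa only [if_pos hsb] using hf.range_eq s ⟨hs.1, hsb⟩
    · simp only [if_neg hsb]
      rw [← hg.range_eq s ⟨(not_le.1 hsb).le, hs.2⟩]
      exact σ.surjective.range_comp (fun m => g m s)

variable [CompleteSpace X]

/-- Peripheral eigenvalues persist under small changes of the parameter, since the contour
integral of the resolvent of `F P` around such an eigenvalue is continuous and not `0`. -/
lemma Admissible.eventually_exists_near (hF : Admissible F) {s₀ : ℝ} (hs₀ : s₀ ∈ Icc (0 : ℝ) 1)
    {μ : ℂ} (hμ : μ ∈ peripheralSpectrum (F s₀)) {ε : ℝ} (hε : 0 < ε) :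
    ∀ᶠ s in 𝓝[Icc 0 1] s₀, ∃ ν ∈ peripheralSpectrum (F s), dist ν μ < ε := by
  have hA := hF.isPeripherallySemisimple hs₀
  obtain ⟨R, hR, hRε, h0, hother, hsub⟩ := hA.exists_contour hμ hε
  have hcont : Tendsto (fun s => F s * peripheralProjector (F s)) (𝓝[Icc 0 1] s₀)
      (𝓝 (F s₀ * peripheralProjector (F s₀))) := hF.contDiffOn.continuousOn s₀ hs₀
  have hval : contourProjector (F s₀ * peripheralProjector (F s₀)) μ R ≠ 0 := by
    rw [hA.contourProjector_peripheralPart hR.le hsub h0, Finset.sum_eq_single μ]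
    · exact hA.projector_ne_zero hμ
    · intro ν hν hne
      rw [Finset.mem_filter, Set.Finite.mem_toFinset] at hν
      exact absurd (Metric.ball_subset_closedBall hν.2) (hother ν hν.1 hne)
    · intro h
      simp [hμ, hR] at h
  have h1 := hcont.eventually ((contDiffAt_contourProjector (n := 0) hR.le
    hsub).continuousAt.eventually_ne hval)
  filter_upwards [h1, hcont.eventually (eventually_sphere_subset_resolventSet hsub),
    self_mem_nhdsWithin] with s hne hsub' hs
  have hAs := hF.isPeripherallySemisimple hs
  by_contra! hall
  apply hne
  rw [hAs.contourProjector_peripheralPart hR.le hsub' h0]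
  refine Finset.sum_eq_zero fun ν hν => ?_
  rw [Finset.mem_filter, Set.Finite.mem_toFinset] at hν
  exact absurd (hν.2.trans_le hRε) (not_lt.2 (hall ν hν.1))

/-- Near each parameter value there is a continuous labelling: the peripheral eigenvalues near a
given one cannot be more than one, because their total number is constant. -/
lemma Admissible.exists_local_labelling (hF : Admissible F) {z : ℕ}
    (hz : ∀ s ∈ Icc (0 : ℝ) 1, (peripheralSpectrum (F s)).ncard = z) {s₀ : ℝ}
    (hs₀ : s₀ ∈ Icc (0 : ℝ) 1) :
    ∃ r > 0, ∃ lam : Fin z → ℝ → ℂ, IsLabellingOn F (Icc 0 1 ∩ Metric.ball s₀ r) lam := by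
  classical
  have hfin := hF.finite_peripheral s₀ hs₀
  -- an enumeration of the peripheral spectrum at `s₀`
  obtain ⟨e, he_inj, he_range⟩ : ∃ e : Fin z → ℂ, Function.Injective e ∧
      range e = peripheralSpectrum (F s₀) := by
    have : Fintype (peripheralSpectrum (F s₀)) := hfin.fintype
    have hcard : Fintype.card (peripheralSpectrum (F s₀)) = z := by
      rw [← hz s₀ hs₀, ← Nat.card_coe_set_eq, Nat.card_eq_fintype_card]
    let E := (Fintype.equivFinOfCardEq hcard).symm
    refine ⟨fun m => E m, Subtype.val_injective.comp E.injective, ?_⟩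
    rw [show (fun m => (E m : ℂ)) = Subtype.val ∘ E from rfl, E.surjective.range_comp,
      Subtype.range_coe]
  have he_mem : ∀ m, e m ∈ peripheralSpectrum (F s₀) := fun m => he_range ▸ mem_range_self m
  -- the balls of radius `ε` about these points are disjoint
  obtain ⟨ε, hε, hsep⟩ : ∃ ε > 0, ∀ i j, i ≠ j → 2 * ε ≤ dist (e i) (e j) := by
    obtain ⟨ε, hε, h⟩ : ∃ ε > 0, ∀ p ∈ (Finset.univ : Finset (Fin z × Fin z)),
        p.1 ≠ p.2 → 2 * ε ≤ dist (e p.1) (e p.2) := by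
      induction (Finset.univ : Finset (Fin z × Fin z)) using Finset.induction_on with
      | empty => exact ⟨1, one_pos, by simp⟩
      | insert p S _ ih =>
        obtain ⟨ε, hε, h⟩ := ih
        by_cases hp : p.1 = p.2
        · refine ⟨ε, hε, fun q hq hne => ?_⟩
          rcases Finset.mem_insert.1 hq with rfl | hq
          · exact absurd hp hne
          · exact h q hq hne
        · have hd : 0 < dist (e p.1) (e p.2) := dist_pos.2 (he_inj.ne hp)
          refine ⟨min ε (dist (e p.1) (e p.2) / 2), by positivity, fun q hq hne => ?_⟩
          rcases Finset.mem_insert.1 hq with rfl | hq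
          · linarith [min_le_right ε (dist (e q.1) (e q.2) / 2)]
          · linarith [min_le_left ε (dist (e p.1) (e p.2) / 2), h q hq hne]
    exact ⟨ε, hε, fun i j hne => h (i, j) (Finset.mem_univ _) hne⟩
  have hev : ∀ᶠ s in 𝓝[Icc 0 1] s₀, ∀ m, ∃ ν ∈ peripheralSpectrum (F s), dist ν (e m) < ε :=
    eventually_all.2 fun m => hF.eventually_exists_near hs₀ (he_mem m) hε
  obtain ⟨r, hr, hball⟩ := Metric.mem_nhdsWithin_iff.1 hev
  have hex : ∀ s ∈ Icc (0 : ℝ) 1 ∩ Metric.ball s₀ r, ∀ m,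
      ∃ ν ∈ peripheralSpectrum (F s), dist ν (e m) < ε := fun s hs => hball ⟨hs.2, hs.1⟩
  choose! lam hlam_mem hlam_dist using fun (m : Fin z) (s : ℝ)
    (hs : s ∈ Icc (0 : ℝ) 1 ∩ Metric.ball s₀ r) => hex s hs m
  have huniq : ∀ (w : ℂ) (i j : Fin z), dist w (e i) < ε → dist w (e j) < ε → i = j := by
    intro w i j hi hj
    by_contra hne
    linarith [hsep i j hne, dist_triangle_left (e i) (e j) w]
  have hinj : ∀ s ∈ Icc (0 : ℝ) 1 ∩ Metric.ball s₀ r, Function.Injective fun m => lam m s :=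
    fun s hs i j hij => huniq _ i j (hlam_dist i s hs) (by
      have : lam i s = lam j s := hij
      rw [this]; exact hlam_dist j s hs)
  have hrange : ∀ s ∈ Icc (0 : ℝ) 1 ∩ Metric.ball s₀ r,
      range (fun m => lam m s) = peripheralSpectrum (F s) := by
    intro s hs
    refine Set.eq_of_subset_of_ncard_le (range_subset_iff.2 fun m => hlam_mem m s hs) ?_
      (hF.finite_peripheral s hs.1)
    rw [hz s hs.1, ← image_univ, ncard_image_of_injective _ (hinj s hs), ncard_univ]
    simp
  refine ⟨r, hr, lam, fun m s₁ hs₁ => ?_, hinj, hrange⟩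
  rw [ContinuousWithinAt, Metric.tendsto_nhds]
  intro η hη
  have hpos : 0 < min η (ε - dist (lam m s₁) (e m)) := lt_min hη (sub_pos.2 (hlam_dist m s₁ hs₁))
  have hnear := (hF.eventually_exists_near hs₁.1 (hlam_mem m s₁ hs₁) hpos).filter_mono
    (nhdsWithin_mono s₁
      (inter_subset_left (s := Icc (0 : ℝ) 1) (t := Metric.ball s₀ r)))
  filter_upwards [hnear, self_mem_nhdsWithin] with s ⟨ν, hν, hd⟩ hs
  obtain ⟨j, rfl⟩ : ν ∈ range fun m => lam m s := by rwa [hrange s hs]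
  have hjm : j = m := by
    refine huniq (lam j s) j m (hlam_dist j s hs) ?_
    have h1 := dist_triangle (lam j s) (lam m s₁) (e m)
    have h2 := hd.trans_le (min_le_right _ _)
    simp only at h2
    linarith
  subst hjm
  exact hd.trans_le (min_le_left _ _)

/-- The peripheral eigenvalues of an admissible family have a continuous labelling. -/
lemma Admissible.exists_labelling (hF : Admissible F) :
    ∃ (z : ℕ) (lam : Fin z → ℝ → ℂ), IsPeripheralLabelling F lam := by
  obtain ⟨z, hz⟩ := hF.no_crossing
  obtain ⟨lam, h⟩ := relation_zero_one_of_local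
    (R := fun a b => ∃ lam : Fin z → ℝ → ℂ, IsLabellingOn F (Icc a b) lam)
    (fun a b c _ _ hab hbc h₁ h₂ => exists_isLabellingOn_trans hab hbc h₁ h₂) fun s hs => by
      obtain ⟨r, hr, lam, h⟩ := hF.exists_local_labelling hz hs
      refine ⟨r, hr, fun a ha b hb _ hda hdb => ⟨lam, h.mono fun t ht => ?_⟩⟩
      exact ⟨⟨ha.1.trans ht.1, ht.2.trans hb.2⟩,
        (convex_ball s r).ordConnected.out hda hdb ht⟩
  exact ⟨z, lam, h.continuousOn, h.injective, h.range_eq⟩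

section Labelling

variable {z : ℕ} {lam : Fin z → ℝ → ℂ}

/-- The spectral projectors are locally contour integrals, over a fixed circle, of the resolvent
of the `C²` family `F P`. -/
lemma IsPeripheralLabelling.contDiffOn_eigenProjector (hlam : IsPeripheralLabelling F lam)
    (hF : Admissible F) (m : Fin z) : ContDiffOn ℝ 2 (eigenProjector F lam m) (Icc 0 1) := by
  intro s₀ hs₀
  have hmem : ∀ s ∈ Icc (0 : ℝ) 1, ∀ j, lam j s ∈ peripheralSpectrum (F s) := fun s hs j =>
    hlam.range_eq s hs ▸ mem_range_self j
  have hA := hF.isPeripherallySemisimple hs₀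
  obtain ⟨R, hR, -, h0, hother, hsub⟩ := hA.exists_contour (hmem s₀ hs₀ m) one_pos
  have hG : ContDiffWithinAt ℝ 2 (fun s => F s * peripheralProjector (F s)) (Icc 0 1) s₀ :=
    hF.contDiffOn s₀ hs₀
  have hcomp : ContDiffWithinAt ℝ 2
      (fun s => contourProjector (F s * peripheralProjector (F s)) (lam m s₀) R) (Icc 0 1) s₀ :=
    ContDiffAt.comp_contDiffWithinAt (g := fun b => contourProjector b (lam m s₀) R) s₀
      (contDiffAt_contourProjector hR.le hsub) hG
  have hin : ∀ᶠ s in 𝓝[Icc 0 1] s₀, lam m s ∈ Metric.ball (lam m s₀) R :=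
    (hlam.continuousOn m s₀ hs₀).eventually (Metric.ball_mem_nhds _ hR)
  have hout : ∀ᶠ s in 𝓝[Icc 0 1] s₀, ∀ j, j ≠ m → lam j s ∉ Metric.closedBall (lam m s₀) R := by
    refine eventually_all.2 fun j => ?_
    by_cases hj : j = m
    · exact Eventually.of_forall fun _ h => absurd hj h
    · have hne : lam j s₀ ≠ lam m s₀ := fun h => hj (hlam.injective s₀ hs₀ h)
      filter_upwards [(hlam.continuousOn j s₀ hs₀).eventually
        (Metric.isClosed_closedBall.isOpen_compl.mem_nhds
          (hother _ (hmem s₀ hs₀ j) hne))] with s hs _ using hs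
  have heq : ∀ᶠ s in 𝓝[Icc 0 1] s₀, eigenProjector F lam m s =
      contourProjector (F s * peripheralProjector (F s)) (lam m s₀) R := by
    filter_upwards [hin, hout, hG.continuousWithinAt.eventually
      (eventually_sphere_subset_resolventSet hsub), self_mem_nhdsWithin] with s hsin hsout hssub hs
    have hAs := hF.isPeripherallySemisimple hs
    rw [hAs.contourProjector_peripheralPart hR.le hssub h0, Finset.sum_eq_single (lam m s)]
    · rfl
    · intro ν hν hne
      rw [Finset.mem_filter, Set.Finite.mem_toFinset, ← hlam.range_eq s hs] at hν
      obtain ⟨⟨j, rfl⟩, hd⟩ := hν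
      exact absurd (Metric.ball_subset_closedBall hd) (hsout j fun h => hne (by rw [h]))
    · intro h
      rw [Finset.mem_filter, Set.Finite.mem_toFinset] at h
      exact absurd ⟨hmem s hs m, hsin⟩ h
  exact hcomp.congr_of_eventuallyEq heq (heq.self_of_nhdsWithin hs₀)

/-- Each eigenvalue is locally the quotient `φ (F P Pᵐ) / φ (Pᵐ)` for a linear functional `φ`. -/
lemma IsPeripheralLabelling.contDiffOn_eigenvalue (hlam : IsPeripheralLabelling F lam)
    (hF : Admissible F) (m : Fin z) : ContDiffOn ℝ 2 (lam m) (Icc 0 1) := by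
  intro s₀ hs₀
  have hmem : ∀ s ∈ Icc (0 : ℝ) 1, lam m s ∈ peripheralSpectrum (F s) := fun s hs =>
    hlam.range_eq s hs ▸ mem_range_self m
  have hne : eigenProjector F lam m s₀ ≠ 0 :=
    (hF.isPeripherallySemisimple hs₀).projector_ne_zero (hmem s₀ hs₀)
  obtain ⟨φ, -, hφ⟩ := exists_dual_vector ℂ _ (norm_ne_zero_iff.2 hne)
  have hφ0 : φ (eigenProjector F lam m s₀) ≠ 0 := by
    rw [hφ]
    simpa using hne
  have hP := hlam.contDiffOn_eigenProjector hF m s₀ hs₀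
  have hlin : ContDiff ℝ 2 φ := (φ.restrictScalars ℝ).contDiff
  have hden : ContDiffWithinAt ℝ 2 (fun s => φ (eigenProjector F lam m s)) (Icc 0 1) s₀ :=
    hlin.contDiffAt.comp_contDiffWithinAt s₀ hP
  have hnum : ContDiffWithinAt ℝ 2 (fun s => φ (F s * peripheralProjector (F s) *
      eigenProjector F lam m s)) (Icc 0 1) s₀ :=
    hlin.contDiffAt.comp_contDiffWithinAt s₀ ((hF.contDiffOn s₀ hs₀).mul hP)
  have heq : ∀ᶠ s in 𝓝[Icc 0 1] s₀, lam m s = φ (F s * peripheralProjector (F s) *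
      eigenProjector F lam m s) * (φ (eigenProjector F lam m s))⁻¹ := by
    filter_upwards [hden.continuousWithinAt.eventually_ne hφ0, self_mem_nhdsWithin] with s hs hsI
    have h1 : F s * peripheralProjector (F s) * eigenProjector F lam m s =
        lam m s • eigenProjector F lam m s :=
      (hF.isPeripherallySemisimple hsI).peripheralPart_mul_projector (hmem s hsI)
    rw [h1, map_smul, smul_eq_mul, mul_assoc, mul_inv_cancel₀ hs, mul_one]
  exact ContDiffWithinAt.congr_of_eventuallyEq (hnum.mul (hden.inv hφ0)) heq
    (heq.self_of_nhdsWithin hs₀)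

end Labelling

end Family

end DiscreteAdiabatic

/-! ### Linear differential equations and intertwining operators -/

namespace DiscreteAdiabatic

section LinearODE

variable {𝔸 : Type*} [NormedRing 𝔸] [NormedAlgebra ℝ 𝔸] {K : ℝ → 𝔸}

lemma exists_norm_le_of_continuousOn_Icc {E : Type*} [SeminormedAddCommGroup E] {f : ℝ → E}
    (hf : ContinuousOn f (Icc 0 1)) : ∃ C : ℝ, 0 ≤ C ∧ ∀ s ∈ Icc (0 : ℝ) 1, ‖f s‖ ≤ C := by
  obtain ⟨C, hC⟩ := isCompact_Icc.exists_bound_of_continuousOn hf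
  exact ⟨C, (norm_nonneg _).trans (hC 0 ⟨le_rfl, zero_le_one⟩), hC⟩

lemma hasDerivWithinAt_Ici_of_Icc {E : Type*} [NormedAddCommGroup E] [NormedSpace ℝ E] {f : ℝ → E}
    {f' : E} {s : ℝ} (h : HasDerivWithinAt f f' (Icc 0 1) s) (hs : s ∈ Ico (0 : ℝ) 1) :
    HasDerivWithinAt f f' (Ici s) s :=
  h.mono_of_mem_nhdsWithin (mem_of_superset (Icc_mem_nhdsGE hs.2) (Icc_subset_Icc_left hs.1))

lemma linearODE_unique (hK : ContinuousOn K (Icc 0 1)) {Y Z : ℝ → 𝔸}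
    (hY : ∀ s ∈ Icc (0 : ℝ) 1, HasDerivWithinAt Y (K s * Y s) (Icc 0 1) s)
    (hZ : ∀ s ∈ Icc (0 : ℝ) 1, HasDerivWithinAt Z (K s * Z s) (Icc 0 1) s) (h0 : Y 0 = Z 0) :
    EqOn Y Z (Icc 0 1) := by
  obtain ⟨C, hC0, hC⟩ := exists_norm_le_of_continuousOn_Icc hK
  refine ODE_solution_unique_of_mem_Icc_right (v := fun s y => K s * y) (s := fun _ => univ)
    (K := ⟨C, hC0⟩) (fun s hs => ?_) (fun s hs => (hY s hs).continuousWithinAt)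
    (fun s hs => hasDerivWithinAt_Ici_of_Icc (hY s (Ico_subset_Icc_self hs)) hs) (fun _ _ => mem_univ _)
    (fun s hs => (hZ s hs).continuousWithinAt)
    (fun s hs => hasDerivWithinAt_Ici_of_Icc (hZ s (Ico_subset_Icc_self hs)) hs) (fun _ _ => mem_univ _) h0
  refine LipschitzOnWith.of_dist_le_mul fun x _ y _ => ?_
  rw [dist_eq_norm, dist_eq_norm, ← mul_sub]
  exact (norm_mul_le _ _).trans (mul_le_mul_of_nonneg_right (hC s (Ico_subset_Icc_self hs))
    (norm_nonneg _))

/-- The solution with initial value `1` of a linear equation `W' = K W`, from local solutions that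
are composed along `[0,1]`. -/
lemma exists_linearODE_solution [CompleteSpace 𝔸] (hK : ContinuousOn K (Icc 0 1)) :
    ∃ W : ℝ → 𝔸, W 0 = 1 ∧
      ∀ s ∈ Icc (0 : ℝ) 1, HasDerivWithinAt W (K s * W s) (Icc 0 1) s := by
  obtain ⟨C, hC0, hC⟩ := exists_norm_le_of_continuousOn_Icc hK
  refine relation_zero_one_of_local (R := fun a b => ∃ W : ℝ → 𝔸, W a = 1 ∧
    ∀ s ∈ Icc a b, HasDerivWithinAt W (K s * W s) (Icc a b) s) ?_ ?_
  · rintro a b c - - hab hbc ⟨V, hVa, hV⟩ ⟨W, hWb, hW⟩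
    let Y : ℝ → 𝔸 := fun s => if s ≤ b then V s else W s * V b
    have hYV : ∀ s ∈ Icc a b, Y s = V s := fun s hs => if_pos hs.2
    have hYW : ∀ s ∈ Icc b c, Y s = W s * V b := fun s hs => by
      by_cases hsb : s ≤ b
      · rw [le_antisymm hsb hs.1, hYV b ⟨hab, le_rfl⟩, hWb, one_mul]
      · exact if_neg hsb
    refine ⟨Y, (hYV a ⟨le_rfl, hab⟩).trans hVa, fun s hs => ?_⟩
    rw [← Icc_union_Icc_eq_Icc hab hbc]
    refine HasDerivWithinAt.union ?_ ?_
    · by_cases hm : s ∈ Icc a b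
      · rw [hYV s hm]
        exact (hV s hm).congr hYV (hYV s hm)
      · exact HasFDerivWithinAt.of_notMem_closure (by rwa [isClosed_Icc.closure_eq])
    · by_cases hm : s ∈ Icc b c
      · rw [hYW s hm, ← mul_assoc]
        exact ((hW s hm).mul_const (V b)).congr hYW (hYW s hm)
      · exact HasFDerivWithinAt.of_notMem_closure (by rwa [isClosed_Icc.closure_eq])
  · intro s hs
    set L : ℝ := C * (‖(1 : 𝔸)‖ + 1) with hL
    have hL0 : 0 ≤ L := by positivity
    -- on intervals of length at most `1 / (L + 1)` solutions stay in the unit ball about `1`, where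
    -- `L` bounds the right-hand side
    refine ⟨1 / (2 * (L + 1)), by positivity, fun a ha b hb hab hda hdb => ?_⟩
    have hsub : Icc a b ⊆ Icc 0 1 := Icc_subset_Icc ha.1 hb.2
    have hlen : L * (b - a) ≤ 1 := by
      have h1 : b - a ≤ 1 / (L + 1) := by
        have h2 : b - a ≤ dist a s + dist b s := by
          rw [Real.dist_eq, Real.dist_eq]
          linarith [neg_abs_le (a - s), le_abs_self (b - s)]
        have h3 : 1 / (2 * (L + 1)) + 1 / (2 * (L + 1)) = 1 / (L + 1) := by
          field_simp; norm_num
        linarith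
      calc L * (b - a) ≤ L * (1 / (L + 1)) := mul_le_mul_of_nonneg_left h1 hL0
        _ ≤ 1 := by rw [mul_one_div, div_le_one (by positivity)]; linarith
    have hPL : IsPicardLindelof (fun t (x : 𝔸) => K t * x) (⟨a, le_rfl, hab⟩ : Icc a b) 1 1 0
        ⟨L, hL0⟩ ⟨C, hC0⟩ := by
      refine ⟨fun t ht => ?_, fun x _ => (hK.mono hsub).mul continuousOn_const, fun t ht x hx => ?_,
        ?_⟩
      · refine LipschitzOnWith.of_dist_le_mul fun x _ y _ => ?_
        rw [dist_eq_norm, dist_eq_norm, ← mul_sub]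
        exact (norm_mul_le _ _).trans (mul_le_mul_of_nonneg_right (hC t (hsub ht)) (norm_nonneg _))
      · refine (norm_mul_le _ _).trans (mul_le_mul (hC t (hsub ht)) ?_ (norm_nonneg _) hC0)
        have hx' : ‖x - 1‖ ≤ 1 := by simpa [dist_eq_norm] using hx
        linarith [norm_le_norm_add_norm_sub' x 1]
      · change L * max (b - a) (a - a) ≤ ((1 : NNReal) : ℝ) - ((0 : NNReal) : ℝ)
        simpa [hab] using hlen
    exact hPL.exists_eq_forall_mem_Icc_hasDerivWithinAt₀

end LinearODE

section Intertwining

/-- For a complete family of mutually orthogonal projectors, the generator `K = ∑ Pᵢ' Pᵢ` satisfies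
`K Pⱼ = Pⱼ' Pⱼ`. -/
lemma generator_mul_projector {𝔸 ι : Type*} [NormedRing 𝔸] [Fintype ι] [DecidableEq ι]
    {P P' : ι → ℝ → 𝔸}
    (horth : ∀ s ∈ Icc (0 : ℝ) 1, ∀ i j, P i s * P j s = if i = j then P i s else 0)
    (j : ι) {s : ℝ} (hs : s ∈ Icc (0 : ℝ) 1) :
    (∑ i, P' i s * P i s) * P j s = P' j s * P j s := by
  simp only [Finset.sum_mul, mul_assoc, horth s hs]
  simp

variable {𝔸 : Type*} [NormedRing 𝔸] [NormedAlgebra ℝ 𝔸]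

lemma deriv_mul_add_mul_deriv {p q r p' q' r' : ℝ → 𝔸}
    (hp : ∀ s ∈ Icc (0 : ℝ) 1, HasDerivWithinAt p (p' s) (Icc 0 1) s)
    (hq : ∀ s ∈ Icc (0 : ℝ) 1, HasDerivWithinAt q (q' s) (Icc 0 1) s)
    (hr : ∀ s ∈ Icc (0 : ℝ) 1, HasDerivWithinAt r (r' s) (Icc 0 1) s)
    (h : ∀ s ∈ Icc (0 : ℝ) 1, p s * q s = r s) {s : ℝ} (hs : s ∈ Icc (0 : ℝ) 1) :
    p' s * q s + p s * q' s = r' s :=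
  (uniqueDiffOn_Icc_zero_one s hs).eq_deriv _ ((hp s hs).mul (hq s hs))
    ((hr s hs).congr h (h s hs))

/-- `p p' p = 0` for a differentiable family of idempotents. -/
lemma mul_deriv_mul_self {p p' : ℝ → 𝔸}
    (hp : ∀ s ∈ Icc (0 : ℝ) 1, HasDerivWithinAt p (p' s) (Icc 0 1) s)
    (h : ∀ s ∈ Icc (0 : ℝ) 1, p s * p s = p s) {s : ℝ} (hs : s ∈ Icc (0 : ℝ) 1) :
    p s * p' s * p s = 0 := by
  have h1 := deriv_mul_add_mul_deriv hp hp hp h hs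
  have h2 := congrArg (fun x => p s * x * p s) h1
  simp only [mul_add, add_mul] at h2
  rw [show p s * (p' s * p s) * p s = p s * p' s * (p s * p s) by noncomm_ring,
    show p s * (p s * p' s) * p s = p s * p s * p' s * p s by noncomm_ring, h s hs] at h2
  simpa using h2

variable {ι : Type*} [Fintype ι] [DecidableEq ι] {P P' : ι → ℝ → 𝔸}

/-- `[K, Pⱼ] = Pⱼ'` for the generator `K = ∑ Pᵢ' Pᵢ`. -/
lemma deriv_add_projector_mul_generator
    (hP : ∀ i, ∀ s ∈ Icc (0 : ℝ) 1, HasDerivWithinAt (P i) (P' i s) (Icc 0 1) s)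
    (horth : ∀ s ∈ Icc (0 : ℝ) 1, ∀ i j, P i s * P j s = if i = j then P i s else 0)
    (hsum : ∀ s ∈ Icc (0 : ℝ) 1, ∑ i, P i s = 1) (j : ι) {s : ℝ} (hs : s ∈ Icc (0 : ℝ) 1) :
    P' j s + P j s * ∑ i, P' i s * P i s = (∑ i, P' i s * P i s) * P j s := by
  have h1 : ∀ i, P j s * (P' i s * P i s) = (if j = i then P' j s * P j s else 0) -
      P' j s * P i s := fun i => by
    have h2 : P' j s * P i s + P j s * P' i s = if j = i then P' j s else 0 := by
      by_cases hij : j = i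
      · subst hij
        rw [if_pos rfl]
        exact deriv_mul_add_mul_deriv (hP j) (hP j) (hP j)
          (fun t ht => by rw [horth t ht, if_pos rfl]) hs
      · rw [if_neg hij]
        exact deriv_mul_add_mul_deriv (r := fun _ => 0) (r' := fun _ => 0) (hP j) (hP i)
          (fun t _ => hasDerivWithinAt_const t _ _) (fun t ht => by rw [horth t ht, if_neg hij]) hs
    rw [← mul_assoc, eq_sub_of_add_eq' h2, sub_mul, mul_assoc, horth s hs, if_pos rfl]
    split_ifs with hij
    · rw [hij]
    · rw [zero_mul]
  rw [generator_mul_projector horth j hs, Finset.mul_sum, Finset.sum_congr rfl fun i _ => h1 i,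
    Finset.sum_sub_distrib, ← Finset.mul_sum, hsum s hs]
  simp

/-- The intertwining property `Pⱼ(s) W(s) = W(s) Pⱼ(0)`: both sides solve the same linear
equation. -/
lemma projector_mul_intertwiner
    (hP : ∀ i, ∀ s ∈ Icc (0 : ℝ) 1, HasDerivWithinAt (P i) (P' i s) (Icc 0 1) s)
    (hP' : ∀ i, ContinuousOn (P' i) (Icc 0 1))
    (horth : ∀ s ∈ Icc (0 : ℝ) 1, ∀ i j, P i s * P j s = if i = j then P i s else 0)
    (hsum : ∀ s ∈ Icc (0 : ℝ) 1, ∑ i, P i s = 1) {W : ℝ → 𝔸} (hW0 : W 0 = 1)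
    (hW : ∀ s ∈ Icc (0 : ℝ) 1, HasDerivWithinAt W ((∑ i, P' i s * P i s) * W s) (Icc 0 1) s)
    (j : ι) {s : ℝ} (hs : s ∈ Icc (0 : ℝ) 1) : P j s * W s = W s * P j 0 := by
  have hK : ContinuousOn (fun s => ∑ i, P' i s * P i s) (Icc 0 1) :=
    continuousOn_finsetSum _ fun i _ =>
      (hP' i).mul fun t ht => (hP i t ht).continuousWithinAt
  refine linearODE_unique hK (Y := fun s => P j s * W s) (Z := fun s => W s * P j 0)
    (fun t ht => ?_) (fun t ht => ?_) (by simp [hW0]) hs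
  · convert! (hP j t ht).mul (hW t ht) using 1
    rw [← mul_assoc, ← mul_assoc, ← add_mul, deriv_add_projector_mul_generator hP horth hsum j ht]
  · convert! (hW t ht).mul_const (P j 0) using 1
    rw [mul_assoc]

end Intertwining

end DiscreteAdiabatic

/-! ### Products of steps -/

namespace DiscreteAdiabatic

section StepProduct

variable {𝔸 : Type*} [NormedRing 𝔸]

/-- The product `a (j + n) ⋯ a (j + 2) a (j + 1)` of `n` consecutive steps after the step `j`. -/
def stepProduct (a : ℕ → 𝔸) (j : ℕ) : ℕ → 𝔸
  | 0 => 1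
  | n + 1 => a (j + n + 1) * stepProduct a j n

lemma stepProduct_add (a : ℕ → 𝔸) (j m n : ℕ) :
    stepProduct a j (m + n) = stepProduct a (j + m) n * stepProduct a j m := by
  induction n with
  | zero => simp [stepProduct]
  | succ n ih =>
    rw [← add_assoc, stepProduct, ih, stepProduct, mul_assoc, add_assoc j m n]

variable {a : ℕ → 𝔸}

/-- A product of nearly equal steps is close to a power. -/
lemma norm_stepProduct_sub_pow_le [NormOneClass 𝔸] {b : 𝔸} {q η : ℝ} (hq : 1 ≤ q) {j : ℕ} {n : ℕ}
    (ha : ∀ i, 1 ≤ i → i ≤ n → ‖a (j + i) - b‖ ≤ η) (haq : ∀ i, 1 ≤ i → i ≤ n → ‖a (j + i)‖ ≤ q)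
    (hb : ‖b‖ ≤ q) : ‖stepProduct a j n - b ^ n‖ ≤ n * q ^ n * η ∧ ‖stepProduct a j n‖ ≤ q ^ n := by
  induction n with
  | zero => simp [stepProduct]
  | succ n ih =>
    obtain ⟨h1, h2⟩ := ih (fun i hi hin => ha i hi (hin.trans n.le_succ))
      (fun i hi hin => haq i hi (hin.trans n.le_succ))
    have hη : ‖a (j + n + 1) - b‖ ≤ η := ha (n + 1) (by omega) le_rfl
    have hη0 : 0 ≤ η := (norm_nonneg _).trans hη
    have hq0 : 0 ≤ q := zero_le_one.trans hq
    constructor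
    · have h3 : stepProduct a j (n + 1) - b ^ (n + 1) =
          (a (j + n + 1) - b) * stepProduct a j n + b * (stepProduct a j n - b ^ n) := by
        rw [stepProduct, pow_succ']; noncomm_ring
      rw [h3]
      calc _ ≤ ‖a (j + n + 1) - b‖ * ‖stepProduct a j n‖ + ‖b‖ * ‖stepProduct a j n - b ^ n‖ :=
            (norm_add_le _ _).trans (add_le_add (norm_mul_le _ _) (norm_mul_le _ _))
        _ ≤ η * q ^ n + q * (n * q ^ n * η) := by gcongr
        _ ≤ η * q ^ (n + 1) + q * (n * q ^ n * η) := by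
            gcongr
            omega
        _ = _ := by push_cast; ring
    · rw [stepProduct, pow_succ']
      exact (norm_mul_le _ _).trans (mul_le_mul (haq (n + 1) (by omega) le_rfl) h2
        (norm_nonneg _) hq0)

/-- Decay of products whose blocks of length `N` have norm at most `l ^ N`. -/
lemma norm_stepProduct_le_of_blocks [NormOneClass 𝔸] {q l : ℝ} (hq : 1 ≤ q) (hl : 0 < l)
    (hl1 : l ≤ 1) {N T : ℕ} (hN : 1 ≤ N) (haq : ∀ i, 1 ≤ i → i ≤ T → ‖a i‖ ≤ q)
    (hblock : ∀ j, j + N ≤ T → ‖stepProduct a j N‖ ≤ l ^ N) (n : ℕ) :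
    ∀ j, j + n ≤ T → ‖stepProduct a j n‖ ≤ (q / l) ^ N * l ^ n := by
  induction n using Nat.strong_induction_on with
  | _ n ih =>
    intro j hjn
    rcases lt_or_ge n N with h | h
    · have h1 : ‖stepProduct a j n‖ ≤ q ^ n := by
        have : ∀ m, m ≤ n → ‖stepProduct a j m‖ ≤ q ^ m := by
          intro m
          induction m with
          | zero => simp [stepProduct]
          | succ m ihm =>
            intro hm
            rw [stepProduct, pow_succ']
            exact (norm_mul_le _ _).trans (mul_le_mul (haq _ (by omega) (by omega))
              (ihm (by omega)) (norm_nonneg _) (by linarith))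
        exact this n le_rfl
      have h2 : l ^ N ≤ l ^ n := pow_le_pow_of_le_one hl.le hl1 h.le
      calc ‖stepProduct a j n‖ ≤ q ^ n := h1
        _ ≤ q ^ N := pow_le_pow_right₀ hq h.le
        _ = (q / l) ^ N * l ^ N := by rw [← mul_pow, div_mul_cancel₀ _ hl.ne']
        _ ≤ (q / l) ^ N * l ^ n := by gcongr
    · obtain ⟨m, rfl⟩ := Nat.exists_eq_add_of_le' h
      rw [stepProduct_add]
      calc _ ≤ ‖stepProduct a (j + m) N‖ * ‖stepProduct a j m‖ := norm_mul_le _ _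
        _ ≤ l ^ N * ((q / l) ^ N * l ^ m) :=
            mul_le_mul (hblock _ (by omega)) (ih m (by omega) j (by omega)) (norm_nonneg _)
              (by positivity)
        _ = _ := by rw [pow_add]; ring

/-- Variation of constants for a linear recursion. -/
lemma eq_stepProduct_mul_add_sum {x r : ℕ → 𝔸} {T : ℕ}
    (hx : ∀ k < T, x (k + 1) = a (k + 1) * x k + r k) :
    ∀ k ≤ T, x k = stepProduct a 0 k * x 0 +
      ∑ i ∈ Finset.range k, stepProduct a (i + 1) (k - 1 - i) * r i := by
  intro k
  induction k with
  | zero => simp [stepProduct]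
  | succ k ih =>
    intro hk
    rw [hx k hk, ih (by omega), Finset.sum_range_succ, mul_add, Finset.mul_sum, stepProduct]
    have h1 : ∀ i ∈ Finset.range k, a (k + 1) * (stepProduct a (i + 1) (k - 1 - i) * r i) =
        stepProduct a (i + 1) (k + 1 - 1 - i) * r i := fun i hi => by
      have hi' := Finset.mem_range.1 hi
      rw [show k + 1 - 1 - i = (k - 1 - i) + 1 by omega, stepProduct,
        show i + 1 + (k - 1 - i) + 1 = k + 1 by omega, mul_assoc]
    rw [Finset.sum_congr rfl h1]
    simp [stepProduct, mul_assoc, add_assoc]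

end StepProduct

lemma le_of_le_add_mul_sum {u : ℕ → ℝ} {A b : ℝ} (hb : 0 ≤ b) {T : ℕ}
    (hu : ∀ k ≤ T, u k ≤ A + b * ∑ i ∈ Finset.range k, u i) :
    ∀ k ≤ T, u k ≤ A * (1 + b) ^ k := by
  have h : ∀ k ≤ T, A + b * ∑ i ∈ Finset.range k, u i ≤ A * (1 + b) ^ k := by
    intro k
    induction k with
    | zero => simp
    | succ k ih =>
      intro hk
      have h1 := ih (by omega)
      have h2 := hu k (by omega)
      rw [Finset.sum_range_succ, pow_succ]
      nlinarith
  exact fun k hk => (hu k hk).trans (h k hk)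

/-- A discrete Grönwall inequality on the scale `1 / T`. -/
lemma le_mul_exp_of_le_add_mul_sum {u : ℕ → ℝ} {A c : ℝ} (hA : 0 ≤ A) (hc : 0 ≤ c) {T : ℕ}
    (hu : ∀ k ≤ T, u k ≤ A + c / T * ∑ i ∈ Finset.range k, u i) :
    ∀ k ≤ T, u k ≤ A * Real.exp c := by
  intro k hk
  refine (le_of_le_add_mul_sum (by positivity) hu k hk).trans (mul_le_mul_of_nonneg_left ?_ hA)
  have h1 : (1 + c / T) ^ k ≤ Real.exp (c / T) ^ k :=
    pow_le_pow_left₀ (by positivity) (by linarith [Real.add_one_le_exp (c / T)]) k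
  refine h1.trans ?_
  rw [← Real.exp_nat_mul, Real.exp_le_exp]
  rcases Nat.eq_zero_or_pos T with rfl | hT
  · simpa using hc
  · have hT' : (0 : ℝ) < T := by exact_mod_cast hT
    have hk' : (k : ℝ) ≤ T := by exact_mod_cast hk
    rw [mul_div_assoc', div_le_iff₀ hT', mul_comm]
    exact mul_le_mul_of_nonneg_left hk' hc

lemma sum_pow_reflect_le {l : ℝ} (hl0 : 0 ≤ l) (hl1 : l < 1) (k : ℕ) :
    ∑ i ∈ Finset.range k, l ^ (k - 1 - i) ≤ (1 - l)⁻¹ := by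
  rw [Finset.sum_range_reflect (fun i => l ^ i)]
  have h := (summable_geometric_of_lt_one hl0 hl1).sum_le_tsum (Finset.range k)
    fun i _ => pow_nonneg hl0 i
  rwa [tsum_geometric_of_lt_one hl0 hl1] at h

end DiscreteAdiabatic

/-! ### Stability of the discrete evolution -/

namespace DiscreteAdiabatic

section Stability

variable {𝔸 : Type*} [NormedRing 𝔸] [NormedAlgebra ℂ 𝔸]

/-- The projector complementary to the projectors `P m`. -/
def restProjector {z : ℕ} (P : Fin z → ℝ → 𝔸) (s : ℝ) : 𝔸 := 1 - ∑ m, P m s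

/-- The algebraic relations between a family `F`, its peripheral eigenvalues `lam m` and the
spectral projectors `P m` (with derivatives `P' m`, `P'' m`) on `[0,1]`, and one constant `B` that
bounds all the quantities on which the adiabatic estimate depends. -/
structure AdiabaticData (F : ℝ → 𝔸) {z : ℕ} (lam : Fin z → ℝ → ℂ) (P P' P'' : Fin z → ℝ → 𝔸)
    (B : ℝ) : Prop where
  one_le : 1 ≤ B
  card_le : (z : ℝ) ≤ B
  orthogonal : ∀ s ∈ Icc (0 : ℝ) 1, ∀ m n, P m s * P n s = if m = n then P m s else 0
  mul_projector : ∀ s ∈ Icc (0 : ℝ) 1, ∀ m, F s * P m s = lam m s • P m s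
  projector_mul : ∀ s ∈ Icc (0 : ℝ) 1, ∀ m, P m s * F s = lam m s • P m s
  norm_lam : ∀ s ∈ Icc (0 : ℝ) 1, ∀ m, ‖lam m s‖ = 1
  lam_ne : ∀ s ∈ Icc (0 : ℝ) 1, ∀ m n, m ≠ n → lam m s ≠ lam n s
  norm_gap_inv_le : ∀ s ∈ Icc (0 : ℝ) 1, ∀ m n, m ≠ n → ‖(lam m s - lam n s)⁻¹‖ ≤ B
  lam_lipschitz : ∀ s ∈ Icc (0 : ℝ) 1, ∀ t ∈ Icc (0 : ℝ) 1, ∀ m,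
    ‖lam m s - lam m t‖ ≤ B * |s - t|
  hasDeriv : ∀ m, ∀ s ∈ Icc (0 : ℝ) 1, HasDerivWithinAt (P m) (P' m s) (Icc 0 1) s
  hasDeriv' : ∀ m, ∀ s ∈ Icc (0 : ℝ) 1, HasDerivWithinAt (P' m) (P'' m s) (Icc 0 1) s
  norm_projector_le : ∀ s ∈ Icc (0 : ℝ) 1, ∀ m, ‖P m s‖ ≤ B
  norm_deriv_le : ∀ s ∈ Icc (0 : ℝ) 1, ∀ m, ‖P' m s‖ ≤ B
  norm_deriv_two_le : ∀ s ∈ Icc (0 : ℝ) 1, ∀ m, ‖P'' m s‖ ≤ B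
  norm_rest_le : ∀ s ∈ Icc (0 : ℝ) 1, ‖restProjector P s‖ ≤ B
  rest_lipschitz : ∀ s ∈ Icc (0 : ℝ) 1, ∀ t ∈ Icc (0 : ℝ) 1,
    ‖restProjector P s - restProjector P t‖ ≤ B * |s - t|
  norm_inner_le : ∀ s ∈ Icc (0 : ℝ) 1, ‖restProjector P s * F s‖ ≤ B

/-- Decay of the products of the inner parts on the grid of mesh `1 / T`, at the rate `l`. -/
structure InnerDecay (F : ℝ → 𝔸) {z : ℕ} (P : Fin z → ℝ → 𝔸) (B l : ℝ) (T : ℕ) : Prop where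
  nonneg : 0 ≤ l
  lt_one : l < 1
  inv_le : (1 - l)⁻¹ ≤ B
  norm_le : ∀ j n, j + n ≤ T →
    ‖stepProduct (fun i => restProjector P ((i : ℝ) / T) * F ((i : ℝ) / T)) j n‖ ≤ B * l ^ n

lemma grid_mem {k T : ℕ} (h : k ≤ T) : (k : ℝ) / T ∈ Icc (0 : ℝ) 1 :=
  ⟨by positivity, div_le_one_of_le₀ (by exact_mod_cast h) (by positivity)⟩

lemma abs_grid_sub (k T : ℕ) : |((k + 1 : ℕ) : ℝ) / T - (k : ℝ) / T| = (T : ℝ)⁻¹ := by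
  rw [div_sub_div_same]
  push_cast
  rw [add_sub_cancel_left, one_div, abs_of_nonneg (by positivity)]

namespace AdiabaticData

variable {F : ℝ → 𝔸} {z : ℕ} {lam : Fin z → ℝ → ℂ} {P P' P'' : Fin z → ℝ → 𝔸} {B : ℝ}
  (D : AdiabaticData F lam P P' P'' B)
include D

lemma sum_projector_mul {s : ℝ} (hs : s ∈ Icc (0 : ℝ) 1) (m : Fin z) :
    (∑ n, P n s) * P m s = P m s := by
  simp [Finset.sum_mul, D.orthogonal s hs]

lemma projector_mul_sum {s : ℝ} (hs : s ∈ Icc (0 : ℝ) 1) (m : Fin z) :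
    P m s * (∑ n, P n s) = P m s := by
  simp [Finset.mul_sum, D.orthogonal s hs]

lemma projector_mul_rest {s : ℝ} (hs : s ∈ Icc (0 : ℝ) 1) (m : Fin z) :
    P m s * restProjector P s = 0 := by
  rw [restProjector, mul_sub, mul_one, D.projector_mul_sum hs, sub_self]

lemma rest_mul_projector {s : ℝ} (hs : s ∈ Icc (0 : ℝ) 1) (m : Fin z) :
    restProjector P s * P m s = 0 := by
  rw [restProjector, sub_mul, one_mul, D.sum_projector_mul hs, sub_self]

lemma rest_mul_rest {s : ℝ} (hs : s ∈ Icc (0 : ℝ) 1) :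
    restProjector P s * restProjector P s = restProjector P s := by
  conv_lhs => arg 2; rw [restProjector]
  rw [mul_sub, mul_one, Finset.mul_sum, Finset.sum_eq_zero fun m _ => D.rest_mul_projector hs m,
    sub_zero]

lemma commute_rest {s : ℝ} (hs : s ∈ Icc (0 : ℝ) 1) :
    restProjector P s * F s = F s * restProjector P s := by
  rw [restProjector, sub_mul, mul_sub, one_mul, mul_one, Finset.sum_mul, Finset.mul_sum]
  simp only [D.mul_projector s hs, D.projector_mul s hs]

lemma inner_mul_rest {s : ℝ} (hs : s ∈ Icc (0 : ℝ) 1) :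
    restProjector P s * F s * restProjector P s = restProjector P s * F s := by
  rw [D.commute_rest hs, mul_assoc, D.rest_mul_rest hs]

lemma rest_mul_inner {s : ℝ} (hs : s ∈ Icc (0 : ℝ) 1) :
    restProjector P s * (restProjector P s * F s) = restProjector P s * F s := by
  rw [← mul_assoc, D.rest_mul_rest hs]

lemma eq_sum_add_inner {s : ℝ} (hs : s ∈ Icc (0 : ℝ) 1) :
    F s = ∑ m, lam m s • P m s + restProjector P s * F s := by
  rw [D.commute_rest hs, restProjector, mul_sub, mul_one, Finset.mul_sum]
  simp only [D.mul_projector s hs, add_sub_cancel]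

lemma nonneg : 0 ≤ B := zero_le_one.trans D.one_le

lemma sum_le_mul {f : Fin z → ℝ} {c : ℝ} (hc : 0 ≤ c) (h : ∀ m, f m ≤ c) : ∑ m, f m ≤ B * c := by
  calc ∑ m, f m ≤ ∑ _m : Fin z, c := Finset.sum_le_sum fun m _ => h m
    _ = z * c := by simp
    _ ≤ B * c := mul_le_mul_of_nonneg_right D.card_le hc

lemma norm_sum_le {E : Type*} [SeminormedAddCommGroup E] {f : Fin z → E} {c : ℝ} (hc : 0 ≤ c)
    (h : ∀ m, ‖f m‖ ≤ c) : ‖∑ m, f m‖ ≤ B * c :=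
  (_root_.norm_sum_le _ _).trans (D.sum_le_mul hc h)

lemma norm_le {s : ℝ} (hs : s ∈ Icc (0 : ℝ) 1) : ‖F s‖ ≤ 2 * B ^ 2 := by
  have h1 := D.one_le
  rw [D.eq_sum_add_inner hs]
  calc _ ≤ ‖∑ m, lam m s • P m s‖ + ‖restProjector P s * F s‖ := norm_add_le _ _
    _ ≤ B * B + B := by
      refine add_le_add (D.norm_sum_le D.nonneg fun m => ?_) (D.norm_inner_le s hs)
      rw [norm_smul, D.norm_lam s hs, one_mul]
      exact D.norm_projector_le s hs m
    _ ≤ 2 * B ^ 2 := by nlinarith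

lemma projector_lipschitz {s t : ℝ} (hs : s ∈ Icc (0 : ℝ) 1) (ht : t ∈ Icc (0 : ℝ) 1)
    (m : Fin z) : ‖P m s - P m t‖ ≤ B * |s - t| :=
  Convex.norm_image_sub_le_of_norm_hasDerivWithin_le (D.hasDeriv m)
    (fun r hr => D.norm_deriv_le r hr m) (convex_Icc 0 1) ht hs

variable {l : ℝ} {T : ℕ} {y ρ σ : ℕ → 𝔸} {η : ℝ}

/-- Along a perturbed evolution the components in the peripheral eigenspaces grow only through the
variation of the projectors and the perturbation `ρ`. -/
lemma norm_projector_mul_le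
    (hy : ∀ k < T, y (k + 1) = F (((k + 1 : ℕ) : ℝ) / T) * y k + ρ k +
      restProjector P (((k + 1 : ℕ) : ℝ) / T) * σ k) (m : Fin z) :
    ∀ k ≤ T, ‖P m ((k : ℝ) / T) * y k‖ ≤ B * ‖y 0‖ +
      ∑ i ∈ Finset.range k, (B * (T : ℝ)⁻¹ * ‖y i‖ + B * ‖ρ i‖) := by
  intro k
  induction k with
  | zero =>
    intro h0
    simpa using (norm_mul_le _ _).trans (mul_le_mul_of_nonneg_right
      (D.norm_projector_le _ (grid_mem h0) m) (norm_nonneg (y 0)))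
  | succ k ih =>
    intro hk
    have hs := grid_mem (T := T) hk
    have hs' := grid_mem (T := T) (Nat.le_of_succ_le hk)
    have h1 : P m (((k + 1 : ℕ) : ℝ) / T) * y (k + 1) = lam m (((k + 1 : ℕ) : ℝ) / T) •
        (P m ((k : ℝ) / T) * y k + (P m (((k + 1 : ℕ) : ℝ) / T) - P m ((k : ℝ) / T)) * y k) +
        P m (((k + 1 : ℕ) : ℝ) / T) * ρ k := by
      rw [hy k hk, mul_add, mul_add, ← mul_assoc, D.projector_mul _ hs, ← mul_assoc,
        D.projector_mul_rest hs, zero_mul, add_zero, sub_mul, add_sub_cancel, smul_mul_assoc]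
    rw [h1, Finset.sum_range_succ]
    calc _ ≤ ‖lam m (((k + 1 : ℕ) : ℝ) / T)‖ * (‖P m ((k : ℝ) / T) * y k‖ +
          ‖P m (((k + 1 : ℕ) : ℝ) / T) - P m ((k : ℝ) / T)‖ * ‖y k‖) +
          ‖P m (((k + 1 : ℕ) : ℝ) / T)‖ * ‖ρ k‖ := by
          refine (norm_add_le _ _).trans (add_le_add ?_ (norm_mul_le _ _))
          rw [norm_smul]
          exact mul_le_mul_of_nonneg_left ((norm_add_le _ _).trans
            (add_le_add_right (norm_mul_le _ _) _)) (norm_nonneg _)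
      _ ≤ 1 * ((B * ‖y 0‖ + ∑ i ∈ Finset.range k, (B * (T : ℝ)⁻¹ * ‖y i‖ + B * ‖ρ i‖)) +
          B * (T : ℝ)⁻¹ * ‖y k‖) + B * ‖ρ k‖ := by
          have h2 := D.projector_lipschitz hs hs' m
          rw [abs_grid_sub] at h2
          have h3 := ih (Nat.le_of_succ_le hk)
          have h4 := D.norm_projector_le _ hs m
          rw [D.norm_lam _ hs]
          gcongr
      _ = _ := by ring

/-- Along a perturbed evolution the component in the range of the complementary projector is
damped; perturbations `σ` that act in this range contribute only through their supremum. -/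
lemma norm_rest_mul_le (hd : InnerDecay F P B l T)
    (hy : ∀ k < T, y (k + 1) = F (((k + 1 : ℕ) : ℝ) / T) * y k + ρ k +
      restProjector P (((k + 1 : ℕ) : ℝ) / T) * σ k) (hη : 0 ≤ η) (hσ : ∀ k < T, ‖σ k‖ ≤ η) :
    ∀ k ≤ T, ‖restProjector P ((k : ℝ) / T) * y k‖ ≤ B * (B * ‖y 0‖) +
      (∑ i ∈ Finset.range k, B * (B * (B * (T : ℝ)⁻¹) * ‖y i‖ + B * ‖ρ i‖) + B * B * (B * η)) := by
  intro k hk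
  have hB := D.nonneg
  set a : ℕ → 𝔸 := fun i => restProjector P ((i : ℝ) / T) * F ((i : ℝ) / T) with ha
  set r : ℕ → 𝔸 := fun k => a (k + 1) *
      ((restProjector P (((k + 1 : ℕ) : ℝ) / T) - restProjector P ((k : ℝ) / T)) * y k) +
      restProjector P (((k + 1 : ℕ) : ℝ) / T) * ρ k +
      restProjector P (((k + 1 : ℕ) : ℝ) / T) * σ k with hr
  have hx : ∀ k < T, restProjector P (((k + 1 : ℕ) : ℝ) / T) * y (k + 1) =
      a (k + 1) * (restProjector P ((k : ℝ) / T) * y k) + r k := by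
    intro k hk
    have hs : ((k + 1 : ℕ) : ℝ) / T ∈ Icc (0 : ℝ) 1 := grid_mem (Nat.succ_le_of_lt hk)
    have h1 : restProjector P (((k + 1 : ℕ) : ℝ) / T) * F (((k + 1 : ℕ) : ℝ) / T) * y k =
        a (k + 1) * (restProjector P (((k + 1 : ℕ) : ℝ) / T) * y k) := by
      rw [← mul_assoc, ha]
      simp only
      rw [D.inner_mul_rest hs]
    rw [hy k hk, mul_add, mul_add, ← mul_assoc, h1,
      ← mul_assoc _ _ (σ k), D.rest_mul_rest hs, hr]
    noncomm_ring
  have hrk : ∀ i < T, ‖r i‖ ≤ B * (B * (T : ℝ)⁻¹) * ‖y i‖ + B * ‖ρ i‖ + B * η := by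
    intro i hi
    have hs := grid_mem (T := T) (Nat.succ_le_of_lt hi)
    have hs' := grid_mem (T := T) hi.le
    have h2 := D.rest_lipschitz _ hs _ hs'
    rw [abs_grid_sub] at h2
    have h3 := D.norm_rest_le _ hs
    have h4 : ‖a (i + 1)‖ ≤ B := D.norm_inner_le _ hs
    have h5 := hσ i hi
    refine (norm_add₃_le).trans (add_le_add_three ?_ ?_ ?_)
    · refine (norm_mul_le _ _).trans ?_
      rw [mul_assoc]
      refine mul_le_mul h4 ((norm_mul_le _ _).trans ?_) (norm_nonneg _) hB
      gcongr
    · exact (norm_mul_le _ _).trans (by gcongr)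
    · exact (norm_mul_le _ _).trans (by gcongr)
  rw [eq_stepProduct_mul_add_sum (x := fun k => restProjector P ((k : ℝ) / T) * y k) (r := r)
    (a := a) hx k hk]
  refine (norm_add_le _ _).trans (add_le_add ?_ ?_)
  · refine (norm_mul_le _ _).trans (mul_le_mul ?_ ?_ (norm_nonneg _) hB)
    · refine (hd.norm_le 0 k (by omega)).trans (mul_le_of_le_one_right hB ?_)
      exact pow_le_one₀ hd.nonneg hd.lt_one.le
    · exact (norm_mul_le _ _).trans (mul_le_mul_of_nonneg_right
        (D.norm_rest_le _ (grid_mem (Nat.zero_le T))) (norm_nonneg _))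
  · have hterm : ∀ i ∈ Finset.range k, ‖stepProduct a (i + 1) (k - 1 - i) * r i‖ ≤
        B * (B * (B * (T : ℝ)⁻¹) * ‖y i‖ + B * ‖ρ i‖) + B * (B * η) * l ^ (k - 1 - i) := by
      intro i hi
      have hi' := Finset.mem_range.1 hi
      have h6 := hd.norm_le (i + 1) (k - 1 - i) (by omega)
      have h7 : l ^ (k - 1 - i) ≤ 1 := pow_le_one₀ hd.nonneg hd.lt_one.le
      have h8 : 0 ≤ l ^ (k - 1 - i) := pow_nonneg hd.nonneg _
      calc _ ≤ (B * l ^ (k - 1 - i)) *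
            (B * (B * (T : ℝ)⁻¹) * ‖y i‖ + B * ‖ρ i‖ + B * η) :=
            (norm_mul_le _ _).trans (mul_le_mul h6 (hrk i (by omega)) (norm_nonneg _)
              (mul_nonneg hB h8))
        _ = l ^ (k - 1 - i) * (B * (B * (B * (T : ℝ)⁻¹) * ‖y i‖ + B * ‖ρ i‖)) +
            B * (B * η) * l ^ (k - 1 - i) := by ring
        _ ≤ _ := add_le_add (mul_le_of_le_one_left (by positivity) h7) le_rfl
    refine (_root_.norm_sum_le _ _).trans ((Finset.sum_le_sum hterm).trans ?_)
    rw [Finset.sum_add_distrib, ← Finset.mul_sum (f := fun i => l ^ (k - 1 - i))]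
    refine add_le_add_right ?_ _
    calc B * (B * η) * ∑ i ∈ Finset.range k, l ^ (k - 1 - i) ≤ B * (B * η) * B := by
          gcongr
          exact (sum_pow_reflect_le hd.nonneg hd.lt_one k).trans hd.inv_le
      _ = _ := by ring

/-- Stability of the discrete evolution: a perturbed evolution is controlled by its initial value,
the sum of the perturbations `ρ`, and the supremum of those in the range of the complementary
projector. -/
lemma stability (hd : InnerDecay F P B l T)
    (hy : ∀ k < T, y (k + 1) = F (((k + 1 : ℕ) : ℝ) / T) * y k + ρ k +
      restProjector P (((k + 1 : ℕ) : ℝ) / T) * σ k) (hη : 0 ≤ η) (hσ : ∀ k < T, ‖σ k‖ ≤ η) :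
    ∀ k ≤ T, ‖y k‖ ≤ 2 * B ^ 3 * (‖y 0‖ + ∑ i ∈ Finset.range T, ‖ρ i‖ + η) *
      Real.exp (2 * B ^ 3) := by
  have hB := D.nonneg
  have h1B := D.one_le
  refine le_mul_exp_of_le_add_mul_sum (by positivity) (by positivity) fun k hk => ?_
  have h1 : y k = ∑ m, P m ((k : ℝ) / T) * y k + restProjector P ((k : ℝ) / T) * y k := by
    rw [restProjector, sub_mul, one_mul, Finset.sum_mul, add_sub_cancel]
  set S := ∑ i ∈ Finset.range k, ‖y i‖ with hS
  set R := ∑ i ∈ Finset.range k, ‖ρ i‖ with hR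
  have hS0 : 0 ≤ S := Finset.sum_nonneg fun _ _ => norm_nonneg _
  have hR0 : 0 ≤ R := Finset.sum_nonneg fun _ _ => norm_nonneg _
  have hRT : R ≤ ∑ i ∈ Finset.range T, ‖ρ i‖ :=
    Finset.sum_le_sum_of_subset_of_nonneg (Finset.range_mono hk) fun _ _ _ => norm_nonneg _
  have h2 : ‖∑ m, P m ((k : ℝ) / T) * y k‖ ≤ B * (B * ‖y 0‖ + (B * (T : ℝ)⁻¹ * S + B * R)) := by
    refine D.norm_sum_le (by positivity) fun m => ?_
    have := D.norm_projector_mul_le hy m k hk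
    rwa [Finset.sum_add_distrib, ← Finset.mul_sum, ← Finset.mul_sum] at this
  have h3 : ‖restProjector P ((k : ℝ) / T) * y k‖ ≤ B * (B * ‖y 0‖) +
      (B * (B * (B * (T : ℝ)⁻¹) * S + B * R) + B * B * (B * η)) := by
    have := D.norm_rest_mul_le hd hy hη hσ k hk
    rwa [← Finset.mul_sum, Finset.sum_add_distrib, ← Finset.mul_sum, ← Finset.mul_sum] at this
  have h4 : ‖y k‖ ≤ 2 * B ^ 2 * (‖y 0‖ + R) + B ^ 3 * η + (B ^ 2 + B ^ 3) * ((T : ℝ)⁻¹ * S) := by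
    calc ‖y k‖ = ‖∑ m, P m ((k : ℝ) / T) * y k + restProjector P ((k : ℝ) / T) * y k‖ := by
          rw [← h1]
      _ ≤ _ := norm_add_le _ _
      _ ≤ _ := add_le_add h2 h3
      _ = _ := by ring
  have h5 : B ^ 2 ≤ B ^ 3 := pow_le_pow_right₀ h1B (by norm_num)
  calc ‖y k‖ ≤ 2 * B ^ 2 * (‖y 0‖ + R) + B ^ 3 * η + (B ^ 2 + B ^ 3) * ((T : ℝ)⁻¹ * S) := h4
    _ ≤ 2 * B ^ 3 * (‖y 0‖ + ∑ i ∈ Finset.range T, ‖ρ i‖) + 2 * B ^ 3 * η +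
        (B ^ 3 + B ^ 3) * ((T : ℝ)⁻¹ * S) := by
        gcongr
        linarith [pow_nonneg hB 3]
    _ = _ := by rw [div_eq_mul_inv]; ring

end AdiabaticData

end Stability

end DiscreteAdiabatic

/-! ### The corrected adiabatic approximation -/

namespace DiscreteAdiabatic

section Approximation

lemma norm_mul_sub_mul_le {𝔸 : Type*} [SeminormedRing 𝔸] {a a' b b' : 𝔸} {α β M N : ℝ}
    (ha : ‖a'‖ ≤ M) (hb : ‖b‖ ≤ N) (hda : ‖a - a'‖ ≤ α) (hdb : ‖b - b'‖ ≤ β) :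
    ‖a * b - a' * b'‖ ≤ α * N + M * β := by
  have h : a * b - a' * b' = (a - a') * b + a' * (b - b') := by noncomm_ring
  rw [h]
  exact (norm_add_le _ _).trans (add_le_add
    ((norm_mul_le _ _).trans (mul_le_mul hda hb (norm_nonneg _) ((norm_nonneg _).trans hda)))
    ((norm_mul_le _ _).trans (mul_le_mul ha hdb (norm_nonneg _) ((norm_nonneg _).trans ha))))

lemma norm_smul_sub_smul_le {E : Type*} [SeminormedAddCommGroup E] [NormedSpace ℂ E] {a a' : ℂ}
    {b b' : E} {α β M N : ℝ} (ha : ‖a'‖ ≤ M) (hb : ‖b‖ ≤ N) (hda : ‖a - a'‖ ≤ α)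
    (hdb : ‖b - b'‖ ≤ β) : ‖a • b - a' • b'‖ ≤ α * N + M * β := by
  have h : a • b - a' • b' = (a - a') • b + a' • (b - b') := by module
  rw [h]
  refine (norm_add_le _ _).trans (add_le_add ?_ ?_)
  · rw [norm_smul]
    exact mul_le_mul hda hb (norm_nonneg _) ((norm_nonneg _).trans hda)
  · rw [norm_smul]
    exact mul_le_mul ha hdb (norm_nonneg _) ((norm_nonneg _).trans ha)

variable {𝔸 : Type*} [NormedRing 𝔸] [NormedAlgebra ℂ 𝔸]

/-- The functions `Y m = W P m(0)`: parallel transport of the projectors at `0` along the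
eigenspaces. -/
structure IsTransported {z : ℕ} (P P' Y : Fin z → ℝ → 𝔸) : Prop where
  hasDeriv : ∀ m, ∀ s ∈ Icc (0 : ℝ) 1, HasDerivWithinAt (Y m) (P' m s * Y m s) (Icc 0 1) s
  projector_mul : ∀ m, ∀ s ∈ Icc (0 : ℝ) 1, P m s * Y m s = Y m s
  zero : ∀ m, Y m 0 = P m 0

/-- A bound for the derivatives of the transported projectors up to second order. -/
noncomputable def transportBound (B : ℝ) : ℝ := 2 * B ^ 3 * Real.exp B

lemma transportBound_nonneg {B : ℝ} (hB : 0 ≤ B) : 0 ≤ transportBound B := by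
  unfold transportBound
  positivity

/-- The first order correction in `1 / T` of the adiabatic approximation: it cancels the coupling
`F Pᵐ' Y` between different peripheral eigenspaces. -/
noncomputable def corrector {z : ℕ} (lam : Fin z → ℝ → ℂ) (P P' Y : Fin z → ℝ → 𝔸) (m : Fin z)
    (s : ℝ) : 𝔸 :=
  -∑ j, if j = m then 0 else
    (lam j s * (lam m s - lam j s)⁻¹) • (P j s * (P' m s * Y m s))

namespace AdiabaticData

variable {F : ℝ → 𝔸} {z : ℕ} {lam : Fin z → ℝ → ℂ} {P P' P'' Y : Fin z → ℝ → 𝔸} {B : ℝ}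
  (D : AdiabaticData F lam P P' P'' B)
include D

lemma projector_mul_deriv_mul (hY : IsTransported P P' Y) {s : ℝ} (hs : s ∈ Icc (0 : ℝ) 1)
    (m : Fin z) : P m s * (P' m s * Y m s) = 0 := by
  rw [← hY.projector_mul m s hs, ← mul_assoc, ← mul_assoc,
    mul_deriv_mul_self (D.hasDeriv m) (fun t ht => by rw [D.orthogonal t ht, if_pos rfl]) hs,
    zero_mul]

/-- The defining property of the corrector. -/
lemma mul_deriv_add_corrector (hY : IsTransported P P' Y) {s : ℝ} (hs : s ∈ Icc (0 : ℝ) 1)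
    (m : Fin z) :
    F s * (P' m s * Y m s) + (lam m s • corrector lam P P' Y m s -
        F s * corrector lam P P' Y m s) =
      restProjector P s * F s * (P' m s * Y m s) := by
  set V := P' m s * Y m s with hV
  have h1 : lam m s • corrector lam P P' Y m s - F s * corrector lam P P' Y m s =
      -∑ j, lam j s • (P j s * V) := by
    rw [corrector, ← hV, smul_neg, mul_neg, ← neg_sub_neg, neg_neg, neg_neg, ← neg_sub,
      Finset.smul_sum, Finset.mul_sum, ← Finset.sum_sub_distrib]
    congr 1
    refine Finset.sum_congr rfl fun j _ => ?_
    by_cases hj : j = m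
    · subst hj
      simp only [if_true, smul_zero, mul_zero, sub_zero]
      rw [hV, D.projector_mul_deriv_mul hY hs, smul_zero]
    · have hne : lam m s - lam j s ≠ 0 := sub_ne_zero.2 (D.lam_ne s hs m j (Ne.symm hj))
      simp only [if_neg hj]
      rw [mul_smul_comm, ← mul_assoc (F s) (P j s), D.mul_projector s hs, smul_mul_assoc, smul_smul, smul_smul,
        ← sub_smul]
      congr 1
      field_simp
  rw [h1]
  conv_lhs => arg 1; rw [D.eq_sum_add_inner hs]
  rw [add_mul, Finset.sum_mul]
  simp only [smul_mul_assoc]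
  abel

lemma norm_transported_le (hY : IsTransported P P' Y) (m : Fin z) {s : ℝ}
    (hs : s ∈ Icc (0 : ℝ) 1) : ‖Y m s‖ ≤ B * Real.exp B := by
  have h := norm_le_gronwallBound_of_norm_deriv_right_le (f := Y m) (f' := fun s => P' m s * Y m s)
    (δ := B) (K := B) (ε := 0) (a := 0) (b := 1)
    (fun t ht => (hY.hasDeriv m t ht).continuousWithinAt)
    (fun t ht => hasDerivWithinAt_Ici_of_Icc (hY.hasDeriv m t (Ico_subset_Icc_self ht)) ht)
    (by rw [hY.zero]; exact D.norm_projector_le 0 ⟨le_rfl, zero_le_one⟩ m)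
    (fun t ht => by
      rw [add_zero]
      exact (norm_mul_le _ _).trans (mul_le_mul_of_nonneg_right
        (D.norm_deriv_le t (Ico_subset_Icc_self ht) m) (norm_nonneg _))) s hs
  rw [gronwallBound_ε0, sub_zero] at h
  refine h.trans (mul_le_mul_of_nonneg_left (Real.exp_le_exp.2 ?_) D.nonneg)
  exact mul_le_of_le_one_right D.nonneg hs.2

lemma norm_deriv_transported_le (hY : IsTransported P P' Y) (m : Fin z) {s : ℝ}
    (hs : s ∈ Icc (0 : ℝ) 1) : ‖P' m s * Y m s‖ ≤ transportBound B := by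
  have h1 := D.one_le
  have h2 : B ^ 2 ≤ 2 * B ^ 3 := by nlinarith [sq_nonneg B]
  calc _ ≤ ‖P' m s‖ * ‖Y m s‖ := norm_mul_le _ _
    _ ≤ B * (B * Real.exp B) := mul_le_mul (D.norm_deriv_le s hs m) (D.norm_transported_le hY m hs)
        (norm_nonneg _) D.nonneg
    _ = B ^ 2 * Real.exp B := by ring
    _ ≤ transportBound B := mul_le_mul_of_nonneg_right h2 (Real.exp_nonneg _)

lemma deriv_transported_lipschitz (hY : IsTransported P P' Y) (m : Fin z) {s t : ℝ}
    (hs : s ∈ Icc (0 : ℝ) 1) (ht : t ∈ Icc (0 : ℝ) 1) :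
    ‖P' m s * Y m s - P' m t * Y m t‖ ≤ transportBound B * |s - t| := by
  have h1 := D.one_le
  refine Convex.norm_image_sub_le_of_norm_hasDerivWithin_le (f := fun s => P' m s * Y m s)
    (f' := fun s => P'' m s * Y m s + P' m s * (P' m s * Y m s))
    (fun r hr => (D.hasDeriv' m r hr).mul (hY.hasDeriv m r hr)) (fun r hr => ?_)
    (convex_Icc 0 1) ht hs
  have h2 := D.norm_transported_le hY m hr
  have h3 := D.norm_deriv_le r hr m
  calc _ ≤ ‖P'' m r‖ * ‖Y m r‖ + ‖P' m r‖ * (‖P' m r‖ * ‖Y m r‖) :=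
        (norm_add_le _ _).trans (add_le_add (norm_mul_le _ _) ((norm_mul_le _ _).trans
          (mul_le_mul_of_nonneg_left (norm_mul_le _ _) (norm_nonneg _))))
    _ ≤ B * (B * Real.exp B) + B * (B * (B * Real.exp B)) := by
        have := D.norm_deriv_two_le r hr m
        have := D.nonneg
        gcongr
    _ = (B ^ 2 + B ^ 3) * Real.exp B := by ring
    _ ≤ transportBound B := by
        refine mul_le_mul_of_nonneg_right ?_ (Real.exp_nonneg _)
        nlinarith [sq_nonneg B]

lemma norm_taylor_transported_le (hY : IsTransported P P' Y) (m : Fin z) {s t : ℝ}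
    (hs : s ∈ Icc (0 : ℝ) 1) (ht : t ∈ Icc (0 : ℝ) 1) :
    ‖Y m s - Y m t - (s - t) • (P' m t * Y m t)‖ ≤ transportBound B * |s - t| * |s - t| := by
  have hsub : uIcc t s ⊆ Icc 0 1 := ordConnected_Icc.uIcc_subset ht hs
  have h := Convex.norm_image_sub_le_of_norm_hasDerivWithin_le
    (f := fun r => Y m r - (r - t) • (P' m t * Y m t))
    (f' := fun r => P' m r * Y m r - (1 : ℝ) • (P' m t * Y m t)) (s := uIcc t s) (x := t) (y := s)
    (C := transportBound B * |s - t|)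
    (fun r hr => ((hY.hasDeriv m r (hsub hr)).mono hsub).sub
      (((hasDerivWithinAt_id r _).sub_const t).smul_const _))
    (fun r hr => by
      rw [one_smul]
      refine (D.deriv_transported_lipschitz hY m (hsub hr) ht).trans
        (mul_le_mul_of_nonneg_left ?_ (transportBound_nonneg D.nonneg))
      exact abs_sub_left_of_mem_uIcc hr)
    (convex_uIcc t s) left_mem_uIcc right_mem_uIcc
  simpa [sub_right_comm] using h

lemma norm_coefficient_le {s : ℝ} (hs : s ∈ Icc (0 : ℝ) 1) {j m : Fin z} (hjm : j ≠ m) :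
    ‖lam j s * (lam m s - lam j s)⁻¹‖ ≤ B := by
  rw [norm_mul, D.norm_lam s hs, one_mul]
  exact D.norm_gap_inv_le s hs m j hjm.symm

lemma coefficient_lipschitz {s t : ℝ} (hs : s ∈ Icc (0 : ℝ) 1) (ht : t ∈ Icc (0 : ℝ) 1)
    {j m : Fin z} (hjm : j ≠ m) :
    ‖lam j s * (lam m s - lam j s)⁻¹ - lam j t * (lam m t - lam j t)⁻¹‖ ≤
      3 * B ^ 3 * |s - t| := by
  have hB := D.nonneg
  have h1 := D.one_le
  have hg := D.norm_gap_inv_le s hs m j hjm.symm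
  have hg' := D.norm_gap_inv_le t ht m j hjm.symm
  have hne : lam m s - lam j s ≠ 0 := sub_ne_zero.2 (D.lam_ne s hs m j hjm.symm)
  have hne' : lam m t - lam j t ≠ 0 := sub_ne_zero.2 (D.lam_ne t ht m j hjm.symm)
  have hinv : ‖(lam m s - lam j s)⁻¹ - (lam m t - lam j t)⁻¹‖ ≤ 2 * B ^ 3 * |s - t| := by
    have h2 : (lam m s - lam j s)⁻¹ - (lam m t - lam j t)⁻¹ = (lam m s - lam j s)⁻¹ *
        (lam m t - lam j t)⁻¹ * ((lam j s - lam j t) - (lam m s - lam m t)) := by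
      field_simp
      ring
    rw [h2, norm_mul, norm_mul]
    calc _ ≤ B * B * (B * |s - t| + B * |s - t|) := by
          have h3 := (norm_sub_le (lam j s - lam j t) (lam m s - lam m t)).trans
            (add_le_add (D.lam_lipschitz s hs t ht j) (D.lam_lipschitz s hs t ht m))
          gcongr
      _ = _ := by ring
  refine (norm_mul_sub_mul_le (D.norm_lam t ht j).le hg (D.lam_lipschitz s hs t ht j) hinv).trans ?_
  have h3 : B ^ 2 ≤ B ^ 3 := pow_le_pow_right₀ h1 (by norm_num)
  calc _ = (B ^ 2 + 2 * B ^ 3) * |s - t| := by ring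
    _ ≤ _ := mul_le_mul_of_nonneg_right (by linarith) (abs_nonneg _)

lemma norm_corrector_le (hY : IsTransported P P' Y) (m : Fin z) {s : ℝ}
    (hs : s ∈ Icc (0 : ℝ) 1) : ‖corrector lam P P' Y m s‖ ≤ B ^ 3 * transportBound B := by
  have hB := D.nonneg
  have hC := transportBound_nonneg D.nonneg
  rw [corrector, norm_neg, show B ^ 3 * transportBound B = B * (B * (B * transportBound B)) by ring]
  refine D.norm_sum_le (by positivity) fun j => ?_
  split_ifs with hj
  · rw [norm_zero]; positivity
  · rw [norm_smul]
    refine mul_le_mul (D.norm_coefficient_le hs hj) ((norm_mul_le _ _).trans ?_) (norm_nonneg _) hB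
    exact mul_le_mul (D.norm_projector_le s hs j) (D.norm_deriv_transported_le hY m hs)
      (norm_nonneg _) hB

lemma corrector_lipschitz (hY : IsTransported P P' Y) (m : Fin z) {s t : ℝ}
    (hs : s ∈ Icc (0 : ℝ) 1) (ht : t ∈ Icc (0 : ℝ) 1) :
    ‖corrector lam P P' Y m s - corrector lam P P' Y m t‖ ≤
      5 * B ^ 5 * transportBound B * |s - t| := by
  have hB := D.nonneg
  have h1 := D.one_le
  have hC := transportBound_nonneg D.nonneg
  rw [corrector, corrector, neg_sub_neg, ← norm_neg, neg_sub, ← Finset.sum_sub_distrib,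
    show 5 * B ^ 5 * transportBound B * |s - t| = B * (5 * B ^ 4 * transportBound B * |s - t|) by
      ring]
  refine D.norm_sum_le (by positivity) fun j => ?_
  split_ifs with hj
  · rw [sub_zero, norm_zero]; positivity
  · have h2 := norm_mul_sub_mul_le (D.norm_projector_le t ht j)
      (D.norm_deriv_transported_le hY m hs) (D.projector_lipschitz hs ht j)
      (D.deriv_transported_lipschitz hY m hs ht)
    have h3 : ‖P j s * (P' m s * Y m s)‖ ≤ B * transportBound B :=
      (norm_mul_le _ _).trans (mul_le_mul (D.norm_projector_le s hs j)
        (D.norm_deriv_transported_le hY m hs) (norm_nonneg _) hB)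
    refine (norm_smul_sub_smul_le (D.norm_coefficient_le ht hj) h3
      (D.coefficient_lipschitz hs ht hj) h2).trans ?_
    have h4 : B ^ 2 ≤ B ^ 4 := pow_le_pow_right₀ h1 (by norm_num)
    calc _ = (3 * B ^ 4 + 2 * B ^ 2) * transportBound B * |s - t| := by ring
      _ ≤ _ := by
          gcongr
          linarith

end AdiabaticData

end Approximation

end DiscreteAdiabatic

/-! ### The adiabatic error -/

namespace DiscreteAdiabatic

section Error

variable {𝔸 : Type*} [NormedRing 𝔸] [NormedAlgebra ℂ 𝔸]

/-- The defect of the corrected approximation in one step, in one peripheral eigenspace. -/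
lemma approximation_step {f q v x x' y y' : 𝔸} {Λ μ : ℂ} {h : ℝ} (hy : f * y' = μ • y')
    (hx : f * v + (μ • x' - f * x') = q * f * v) :
    (Λ * μ) • (y' + h • x') - f * (Λ • (y + h • x)) =
      Λ • (h • (q * f * v)) - Λ • (f * ((y - y' + h • v) - h • (x' - x))) := by
  rw [← hx]
  simp only [mul_add, mul_sub, mul_smul_comm, hy]
  module

/-- The constant of the adiabatic estimate, in terms of the common bound `B`. -/
noncomputable def errorConstant (B : ℝ) : ℝ :=
  2 * B ^ 3 * (B ^ 4 * transportBound B + (12 * B ^ 8 * transportBound B + 2 * B ^ 6) +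
    B ^ 2 * transportBound B) * Real.exp (2 * B ^ 3) + B ^ 4 * transportBound B

namespace AdiabaticData

variable {F : ℝ → 𝔸} {z : ℕ} {lam : Fin z → ℝ → ℂ} {P P' P'' Y : Fin z → ℝ → 𝔸} {B : ℝ}
  (D : AdiabaticData F lam P P' P'' B)
include D

lemma norm_prod_lam {T k : ℕ} (hk : k ≤ T) (m : Fin z) :
    ‖∏ n ∈ Finset.Icc 1 k, lam m ((n : ℝ) / T)‖ = 1 := by
  rw [norm_prod]
  exact Finset.prod_eq_one fun n hn =>
    D.norm_lam _ (grid_mem ((Finset.mem_Icc.1 hn).2.trans hk)) m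

lemma rest_mul_stepProduct {T k : ℕ} (hk : k ≤ T) :
    restProjector P ((k : ℝ) / T) * (stepProduct (fun i : ℕ => restProjector P ((i : ℝ) / T) *
        F ((i : ℝ) / T)) 0 k * restProjector P 0) =
      stepProduct (fun i : ℕ => restProjector P ((i : ℝ) / T) * F ((i : ℝ) / T)) 0 k *
        restProjector P 0 := by
  cases k with
  | zero => simp [stepProduct, D.rest_mul_rest ⟨le_rfl, zero_le_one⟩]
  | succ k =>
    rw [stepProduct, zero_add, ← mul_assoc, ← mul_assoc, D.rest_mul_inner (grid_mem hk)]

/-- The discrete adiabatic theorem with one common bound `B`. -/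
theorem adiabatic_error (hY : IsTransported P P' Y) {l : ℝ} {T : ℕ} (hT : 0 < T)
    (hd : InnerDecay F P B l T) {k : ℕ} (hk : k ≤ T) :
    ‖stepProduct (fun i : ℕ => F ((i : ℝ) / T)) 0 k -
        ∑ m, (∏ n ∈ Finset.Icc 1 k, lam m ((n : ℝ) / T)) • Y m ((k : ℝ) / T) -
        stepProduct (fun i : ℕ => restProjector P ((i : ℝ) / T) * F ((i : ℝ) / T)) 0 k *
          restProjector P 0‖ ≤ errorConstant B / T := by
  have hB := D.nonneg
  have h1B := D.one_le
  have hC := transportBound_nonneg D.nonneg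
  have hT' : (0 : ℝ) < T := by exact_mod_cast hT
  set C := transportBound B with hCdef
  set h : ℝ := (T : ℝ)⁻¹ with hh
  have hh0 : 0 ≤ h := by positivity
  have hTh : (T : ℝ) * h = 1 := mul_inv_cancel₀ hT'.ne'
  let s : ℕ → ℝ := fun i => (i : ℝ) / T
  have hs : ∀ i ≤ T, s i ∈ Icc (0 : ℝ) 1 := fun i hi => grid_mem hi
  have hstep : ∀ i, |s i - s (i + 1)| = h := fun i => by
    rw [abs_sub_comm]; exact abs_grid_sub i T
  have hstep' : ∀ i, s i - s (i + 1) = -h := fun i => by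
    simp only [s, hh]
    push_cast
    field_simp
    ring
  let Λ : Fin z → ℕ → ℂ := fun m i => ∏ n ∈ Finset.Icc 1 i, lam m ((n : ℝ) / T)
  have hΛ : ∀ m, ∀ i ≤ T, ‖Λ m i‖ = 1 := fun m i hi => D.norm_prod_lam hi m
  let X : Fin z → ℝ → 𝔸 := corrector lam P P' Y
  let G : ℕ → 𝔸 := fun i =>
    stepProduct (fun i : ℕ => restProjector P ((i : ℝ) / T) * F ((i : ℝ) / T)) 0 i *
      restProjector P 0
  let V : Fin z → ℕ → 𝔸 := fun m i => P' m (s i) * Y m (s i)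
  -- the remainders of the Taylor expansion of `Y m` at the grid point `i + 1`
  let R : Fin z → ℕ → 𝔸 := fun m i => Y m (s i) - Y m (s (i + 1)) + h • V m (i + 1)
  -- the error `y` of the corrected approximation, and its sources: `ρ` is summable over the grid
  -- with sum of order `h`, and `σ`, of order `h` in each step, acts in the range of `Q`
  let y : ℕ → 𝔸 := fun i => stepProduct (fun i : ℕ => F ((i : ℝ) / T)) 0 i -
    (∑ m, Λ m i • (Y m (s i) + h • X m (s i)) + G i)
  let ρ : ℕ → 𝔸 := fun i =>
    ∑ m, Λ m i • (F (s (i + 1)) * (R m i - h • (X m (s (i + 1)) - X m (s i)))) +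
      F (s (i + 1)) * ((restProjector P (s i) - restProjector P (s (i + 1))) * G i)
  let σ : ℕ → 𝔸 := fun i =>
    -∑ m, Λ m i • (h • (restProjector P (s (i + 1)) * F (s (i + 1)) * V m (i + 1)))
  have hG : ∀ i < T, G (i + 1) = F (s (i + 1)) * G i -
      F (s (i + 1)) * ((restProjector P (s i) - restProjector P (s (i + 1))) * G i) := by
    intro i hi
    have h1 : G (i + 1) = restProjector P (s (i + 1)) * F (s (i + 1)) * G i := by
      simp only [G, stepProduct, zero_add, s, mul_assoc]
    have h2 : restProjector P (s i) * G i = G i := D.rest_mul_stepProduct hi.le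
    rw [h1, D.commute_rest (hs _ hi), sub_mul, h2]
    noncomm_ring
  have hrec : ∀ i < T, y (i + 1) = F (s (i + 1)) * y i + ρ i + restProjector P (s (i + 1)) * σ i := by
    intro i hi
    have hsi := hs (i + 1) hi
    have hm : ∀ m, Λ m (i + 1) • (Y m (s (i + 1)) + h • X m (s (i + 1))) =
        F (s (i + 1)) * (Λ m i • (Y m (s i) + h • X m (s i))) +
        (restProjector P (s (i + 1)) *
            (Λ m i • (h • (restProjector P (s (i + 1)) * F (s (i + 1)) * V m (i + 1)))) -
          Λ m i • (F (s (i + 1)) * (R m i - h • (X m (s (i + 1)) - X m (s i))))) := by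
      intro m
      have h1 : F (s (i + 1)) * Y m (s (i + 1)) = lam m (s (i + 1)) • Y m (s (i + 1)) := by
        rw [← hY.projector_mul m _ hsi, ← mul_assoc, D.mul_projector _ hsi, smul_mul_assoc]
      have h2 := approximation_step (Λ := Λ m i) (h := h) (y := Y m (s i)) (x := X m (s i)) h1
        (D.mul_deriv_add_corrector hY hsi m)
      have h3 : Λ m (i + 1) = Λ m i * lam m (s (i + 1)) :=
        Finset.prod_Icc_succ_top (by omega) _
      have h4 : restProjector P (s (i + 1)) *
          (Λ m i • (h • (restProjector P (s (i + 1)) * F (s (i + 1)) * V m (i + 1)))) =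
          Λ m i • (h • (restProjector P (s (i + 1)) * F (s (i + 1)) * V m (i + 1))) := by
        have h5 : ∀ v, restProjector P (s (i + 1)) *
            (restProjector P (s (i + 1)) * F (s (i + 1)) * v) =
            restProjector P (s (i + 1)) * F (s (i + 1)) * v := fun v => by
          rw [← mul_assoc, D.rest_mul_inner hsi]
        rw [mul_smul_comm, mul_smul_comm, h5]
      rw [h4, h3, ← sub_eq_iff_eq_add']
      exact h2
    simp only [y, ρ, σ]
    rw [Finset.sum_congr rfl fun m _ => hm m, Finset.sum_add_distrib, Finset.sum_sub_distrib,
      ← Finset.mul_sum, ← Finset.mul_sum, hG i hi, stepProduct, zero_add]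
    simp only [s]
    noncomm_ring
  have hσ : ∀ i < T, ‖σ i‖ ≤ B ^ 2 * C * h := by
    intro i hi
    rw [norm_neg, show B ^ 2 * C * h = B * (1 * (h * (B * C))) by ring]
    refine D.norm_sum_le (by positivity) fun m => ?_
    rw [norm_smul, norm_smul, hΛ m i hi.le, Real.norm_of_nonneg hh0]
    gcongr
    exact (norm_mul_le _ _).trans (mul_le_mul (D.norm_inner_le _ (hs _ hi))
      (D.norm_deriv_transported_le hY m (hs _ hi)) (norm_nonneg _) hB)
  have hρ : ∀ i < T, ‖ρ i‖ ≤ 12 * B ^ 8 * C * (h * h) + 2 * B ^ 5 * h * l ^ i := by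
    intro i hi
    have hR : ∀ m, ‖R m i‖ ≤ C * h * h := fun m => by
      have h1 := D.norm_taylor_transported_le hY m (hs i hi.le) (hs (i + 1) hi)
      rwa [hstep, hstep', neg_smul, sub_neg_eq_add] at h1
    have hX : ∀ m, ‖h • (X m (s (i + 1)) - X m (s i))‖ ≤ h * (5 * B ^ 5 * C * h) := fun m => by
      rw [norm_smul, Real.norm_of_nonneg hh0, norm_sub_rev]
      have h1 := D.corrector_lipschitz hY m (hs i hi.le) (hs (i + 1) hi)
      rw [hstep] at h1
      exact mul_le_mul_of_nonneg_left h1 hh0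
    have hF := D.norm_le (hs (i + 1) hi)
    have h15 : 1 ≤ B ^ 5 := one_le_pow₀ h1B
    refine (norm_add_le _ _).trans (add_le_add ?_ ?_)
    · rw [show 12 * B ^ 8 * C * (h * h) = B * (1 * (2 * B ^ 2 * (6 * B ^ 5 * C * (h * h)))) by ring]
      refine D.norm_sum_le (by positivity) fun m => ?_
      rw [norm_smul, hΛ m i hi.le]
      gcongr
      refine (norm_mul_le _ _).trans (mul_le_mul hF ?_ (norm_nonneg _) (by positivity))
      refine (norm_sub_le _ _).trans ((add_le_add (hR m) (hX m)).trans ?_)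
      have h2 : 0 ≤ C * h * h := by positivity
      nlinarith
    · have hGi : ‖G i‖ ≤ B * l ^ i * B :=
        (norm_mul_le _ _).trans (mul_le_mul (hd.norm_le 0 i (by omega))
          (D.norm_rest_le 0 ⟨le_rfl, zero_le_one⟩) (norm_nonneg _)
          (mul_nonneg hB (pow_nonneg hd.nonneg _)))
      have hQ := D.rest_lipschitz _ (hs i hi.le) _ (hs (i + 1) hi)
      rw [hstep] at hQ
      calc _ ≤ ‖F (s (i + 1))‖ * (‖restProjector P (s i) - restProjector P (s (i + 1))‖ *
            ‖G i‖) := (norm_mul_le _ _).trans (mul_le_mul_of_nonneg_left (norm_mul_le _ _)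
              (norm_nonneg _))
        _ ≤ 2 * B ^ 2 * (B * h * (B * l ^ i * B)) := by gcongr
        _ = _ := by ring
  have hρsum : ∑ i ∈ Finset.range T, ‖ρ i‖ ≤ (12 * B ^ 8 * C + 2 * B ^ 6) * h := by
    have hgeom : ∑ i ∈ Finset.range T, l ^ i ≤ B := by
      refine le_trans ?_ hd.inv_le
      have h1 := sum_pow_reflect_le hd.nonneg hd.lt_one T
      rwa [Finset.sum_range_reflect (fun i => l ^ i)] at h1
    calc _ ≤ ∑ i ∈ Finset.range T, (12 * B ^ 8 * C * (h * h) + 2 * B ^ 5 * h * l ^ i) :=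
          Finset.sum_le_sum fun i hi => hρ i (Finset.mem_range.1 hi)
      _ = 12 * B ^ 8 * C * h * (T * h) + 2 * B ^ 5 * h * ∑ i ∈ Finset.range T, l ^ i := by
          rw [Finset.sum_add_distrib, Finset.sum_const, Finset.card_range, nsmul_eq_mul,
            ← Finset.mul_sum]
          ring
      _ ≤ 12 * B ^ 8 * C * h * 1 + 2 * B ^ 5 * h * B := by
          rw [hTh]
          gcongr
      _ = _ := by ring
  have hXsum : ∀ i ≤ T, ‖∑ m, Λ m i • (h • X m (s i))‖ ≤ B ^ 4 * C * h := fun i hi => by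
    rw [show B ^ 4 * C * h = B * (1 * (h * (B ^ 3 * C))) by ring]
    refine D.norm_sum_le (by positivity) fun m => ?_
    rw [norm_smul, norm_smul, hΛ m i hi, Real.norm_of_nonneg hh0]
    gcongr
    exact D.norm_corrector_le hY m (hs i hi)
  -- at the initial time only the correction contributes, since the projectors sum to `1`
  have hy0 : ‖y 0‖ ≤ B ^ 4 * C * h := by
    have h1 : y 0 = -∑ m, Λ m 0 • (h • X m (s 0)) := by
      have h2 : ∑ m, Λ m 0 • Y m (s 0) = ∑ m, P m 0 :=
        Finset.sum_congr rfl fun m _ => by simp [Λ, s, hY.zero]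
      simp only [y, smul_add, Finset.sum_add_distrib, h2, G, stepProduct, one_mul, restProjector]
      abel
    rw [h1, norm_neg]
    exact hXsum 0 (Nat.zero_le T)
  have hstab := D.stability hd hrec (by positivity) hσ k hk
  have hsplit : stepProduct (fun i : ℕ => F ((i : ℝ) / T)) 0 k -
      ∑ m, Λ m k • Y m (s k) - G k = y k + ∑ m, Λ m k • (h • X m (s k)) := by
    simp only [y, smul_add, Finset.sum_add_distrib]
    abel
  change ‖stepProduct (fun i : ℕ => F ((i : ℝ) / T)) 0 k -
      ∑ m, Λ m k • Y m (s k) - G k‖ ≤ _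
  rw [hsplit]
  calc _ ≤ ‖y k‖ + ‖∑ m, Λ m k • (h • X m (s k))‖ := norm_add_le _ _
    _ ≤ 2 * B ^ 3 * (B ^ 4 * C * h + (12 * B ^ 8 * C + 2 * B ^ 6) * h + B ^ 2 * C * h) *
        Real.exp (2 * B ^ 3) + B ^ 4 * C * h := by
        refine add_le_add (hstab.trans ?_) (hXsum k hk)
        gcongr
    _ = errorConstant B / T := by
        rw [errorConstant, div_eq_mul_inv, ← hCdef, ← hh]
        ring

end AdiabaticData

end Error

end DiscreteAdiabatic

/-! ### The projectors of an admissible family -/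

namespace DiscreteAdiabatic

section Bridge

variable {X : Type u} [NormedAddCommGroup X] [NormedSpace ℂ X] {F : ℝ → X →L[ℂ] X}
  {z : ℕ} {lam : Fin z → ℝ → ℂ}

lemma orderedProduct_eq_stepProduct (A : ℝ → X →L[ℂ] X) (T k : ℕ) :
    orderedProduct A T k = stepProduct (fun i : ℕ => A ((i : ℝ) / T)) 0 k := by
  induction k with
  | zero => rfl
  | succ k ih => rw [orderedProduct, stepProduct, ih, zero_add]

lemma stepProduct_congr {𝔸 : Type*} [NormedRing 𝔸] {a b : ℕ → 𝔸} {j n : ℕ}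
    (h : ∀ i ≤ j + n, a i = b i) : stepProduct a j n = stepProduct b j n := by
  induction n with
  | zero => rfl
  | succ n ih =>
    rw [stepProduct, stepProduct, ih fun i hi => h i (by omega), h (j + n + 1) (by omega)]

lemma IsPeripheralLabelling.mem (hlam : IsPeripheralLabelling F lam) {s : ℝ}
    (hs : s ∈ Icc (0 : ℝ) 1) (m : Fin z) : lam m s ∈ peripheralSpectrum (F s) :=
  hlam.range_eq s hs ▸ mem_range_self m

lemma IsPeripheralLabelling.peripheralProjector_eq (hlam : IsPeripheralLabelling F lam) {s : ℝ}
    (hs : s ∈ Icc (0 : ℝ) 1) : peripheralProjector (F s) = ∑ m, eigenProjector F lam m s := by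
  rw [peripheralProjector, ← hlam.range_eq s hs, finsum_mem_range (hlam.injective s hs),
    finsum_eq_sum_of_fintype]
  rfl

lemma IsPeripheralLabelling.restProjector_eq (hlam : IsPeripheralLabelling F lam) {s : ℝ}
    (hs : s ∈ Icc (0 : ℝ) 1) : restProjector (eigenProjector F lam) s = complProjector (F s) := by
  rw [restProjector, complProjector, hlam.peripheralProjector_eq hs]

lemma sum_projectorFamily (hlam : IsPeripheralLabelling F lam) {s : ℝ} (hs : s ∈ Icc (0 : ℝ) 1) :
    ∑ i, projectorFamily F lam i s = 1 := by
  rw [Fintype.sum_option]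
  change complProjector (F s) + ∑ m, eigenProjector F lam m s = 1
  rw [← hlam.restProjector_eq hs, restProjector, sub_add_cancel]

lemma nontrivial_of_admissible (hF : Admissible F) : Nontrivial X := by
  by_contra h
  rw [not_nontrivial_iff_subsingleton] at h
  have h1 := hF.spectralRadius_eq_one 0 ⟨le_rfl, zero_le_one⟩
  have : Subsingleton (X →L[ℂ] X) := ⟨fun A B => ContinuousLinearMap.ext fun x =>
    Subsingleton.elim _ _⟩
  rw [spectralRadius, spectrum.of_subsingleton] at h1
  simp at h1

/-- On a grid of mesh less than `t₀ / N` the products of the inner parts decay at the rate `l'`,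
because in each block of `N` steps the inner part is nearly constant. -/
lemma HasBounds.norm_stepProduct_inner_le {δ M q r l' t₀ : ℝ} {N : ℕ} {ω : ℝ → ℝ}
    (hF : Admissible F) (hb : HasBounds F lam δ M q r N ω) (hl : 0 < l') (hl1 : l' ≤ 1)
    (hN : 1 ≤ N)
    (hω : ∀ t, 0 < t → t < t₀ → N * max q 1 ^ N * ω t ≤ l' ^ N - r ^ N) (hr : r ^ N ≤ l' ^ N)
    {T : ℕ} (hT : N < T * t₀) (hT0 : 0 < T) {j n : ℕ} (hjn : j + n ≤ T) :
    ‖stepProduct (fun i : ℕ => innerPart F ((i : ℝ) / T)) j n‖ ≤ (max q 1 / l') ^ N * l' ^ n := by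
  have := nontrivial_of_admissible hF
  have hT' : (0 : ℝ) < T := by exact_mod_cast hT0
  have hN' : (0 : ℝ) < N := by exact_mod_cast hN
  have hq1 : 1 ≤ max q 1 := le_max_right _ _
  have hc : 0 < N * max q 1 ^ N := by positivity
  refine norm_stepProduct_le_of_blocks hq1 hl hl1 (T := T) hN
    (fun i _ hi => (hb.norm_inner _ (grid_mem hi)).trans (le_max_left _ _)) (fun j hj => ?_) n j hjn
  have hs₁ : ((j + 1 : ℕ) : ℝ) / T ∈ Icc (0 : ℝ) 1 := grid_mem (by omega)
  have hη0 : 0 ≤ (l' ^ N - r ^ N) / (N * max q 1 ^ N) := div_nonneg (sub_nonneg.2 hr) hc.le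
  -- all steps of the block after `j` are close to its first one; for `i = 1` the modulus `ω`,
  -- which is controlled only at positive arguments, must not be used
  have hdiff : ∀ i, 1 ≤ i → i ≤ N →
      ‖innerPart F (((j + i : ℕ) : ℝ) / T) - innerPart F (((j + 1 : ℕ) : ℝ) / T)‖ ≤
        (l' ^ N - r ^ N) / (N * max q 1 ^ N) := by
    intro i hi1 hiN
    rcases hi1.eq_or_lt with rfl | hi
    · simpa using hη0
    · refine (hb.modulus_inner _ (grid_mem (by omega)) _ hs₁).trans ?_
      have h1 : |((j + i : ℕ) : ℝ) / T - ((j + 1 : ℕ) : ℝ) / T| = ((i : ℝ) - 1) / T := by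
        have h2 : ((j + i : ℕ) : ℝ) / T - ((j + 1 : ℕ) : ℝ) / T = ((i : ℝ) - 1) / T := by
          push_cast; ring
        have h3 : (1 : ℝ) ≤ i := by exact_mod_cast hi1
        rw [h2, abs_of_nonneg (div_nonneg (by linarith) hT'.le)]
      have hi' : (1 : ℝ) < i := by exact_mod_cast hi
      have hiN' : (i : ℝ) ≤ N := by exact_mod_cast hiN
      rw [h1, le_div_iff₀ hc, mul_comm]
      refine hω _ (div_pos (by linarith) hT') ?_
      rw [div_lt_iff₀ hT', mul_comm]
      linarith
  have h4 := (norm_stepProduct_sub_pow_le (a := fun i : ℕ => innerPart F ((i : ℝ) / T)) (j := j)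
    (n := N) hq1 hdiff
    (fun i _ hi => (hb.norm_inner _ (grid_mem (by omega))).trans (le_max_left _ _))
    ((hb.norm_inner _ hs₁).trans (le_max_left _ _))).1
  rw [mul_div_cancel₀ _ hc.ne'] at h4
  have h5 := hb.norm_inner_pow _ hs₁
  have h6 := norm_le_norm_add_norm_sub' (stepProduct (fun i : ℕ => innerPart F ((i : ℝ) / T)) j N)
    (innerPart F (((j + 1 : ℕ) : ℝ) / T) ^ N)
  linarith

variable [CompleteSpace X]

lemma eigenProjector_orthogonal (hF : Admissible F) (hlam : IsPeripheralLabelling F lam) {s : ℝ}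
    (hs : s ∈ Icc (0 : ℝ) 1) (m n : Fin z) :
    eigenProjector F lam m s * eigenProjector F lam n s =
      if m = n then eigenProjector F lam m s else 0 := by
  have hA := hF.isPeripherallySemisimple hs
  split_ifs with h
  · subst h
    exact hA.projector_mul_self (hlam.mem hs m)
  · exact hA.projector_mul_of_ne (hlam.mem hs m) (hlam.mem hs n) fun h' =>
      h (hlam.injective s hs h')

lemma contDiffOn_projectorFamily (hF : Admissible F) (hlam : IsPeripheralLabelling F lam)
    (i : Option (Fin z)) : ContDiffOn ℝ 2 (projectorFamily F lam i) (Icc 0 1) := by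
  cases i with
  | some m => exact hlam.contDiffOn_eigenProjector hF m
  | none =>
    refine ContDiffOn.congr (f := fun s => 1 - ∑ m, eigenProjector F lam m s)
      (contDiffOn_const.sub (ContDiffOn.sum fun m _ => hlam.contDiffOn_eigenProjector hF m))
      fun s hs => ?_
    exact (hlam.restProjector_eq hs).symm

lemma hasDerivWithinAt_projectorFamily (hF : Admissible F) (hlam : IsPeripheralLabelling F lam)
    (i : Option (Fin z)) {s : ℝ} (hs : s ∈ Icc (0 : ℝ) 1) :
    HasDerivWithinAt (projectorFamily F lam i)
      (derivWithin (projectorFamily F lam i) (Icc 0 1) s) (Icc 0 1) s :=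
  ((contDiffOn_projectorFamily hF hlam i).differentiableOn (by norm_num) s hs).hasDerivWithinAt

lemma contDiffOn_derivWithin_projectorFamily (hF : Admissible F)
    (hlam : IsPeripheralLabelling F lam) (i : Option (Fin z)) :
    ContDiffOn ℝ 1 (derivWithin (projectorFamily F lam i) (Icc 0 1)) (Icc 0 1) :=
  (contDiffOn_projectorFamily hF hlam i).derivWithin uniqueDiffOn_Icc_zero_one (by norm_num)

lemma projectorFamily_orthogonal (hF : Admissible F) (hlam : IsPeripheralLabelling F lam) {s : ℝ}
    (hs : s ∈ Icc (0 : ℝ) 1) (i j : Option (Fin z)) :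
    projectorFamily F lam i s * projectorFamily F lam j s =
      if i = j then projectorFamily F lam i s else 0 := by
  have horth := eigenProjector_orthogonal hF hlam hs
  have hleft : ∀ m, (∑ n, eigenProjector F lam n s) * eigenProjector F lam m s =
      eigenProjector F lam m s := fun m => by simp [Finset.sum_mul, horth]
  have hright : ∀ m, eigenProjector F lam m s * ∑ n, eigenProjector F lam n s =
      eigenProjector F lam m s := fun m => by simp [Finset.mul_sum, horth]
  have hnone : projectorFamily F lam none s = 1 - ∑ n, eigenProjector F lam n s :=
    (hlam.restProjector_eq hs).symm
  have hsome : ∀ m, projectorFamily F lam (some m) s = eigenProjector F lam m s := fun _ => rfl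
  cases i with
  | some m =>
    cases j with
    | some n => simpa [hsome] using horth m n
    | none => simp [hnone, hsome, mul_sub, hright]
  | none =>
    cases j with
    | some n => simp [hnone, hsome, sub_mul, hleft]
    | none =>
      have hsum : (∑ n, eigenProjector F lam n s) * ∑ n, eigenProjector F lam n s =
          ∑ n, eigenProjector F lam n s := by
        rw [Finset.sum_mul]
        exact Finset.sum_congr rfl fun m _ => hright m
      rw [if_pos rfl, hnone, mul_sub, mul_one, sub_mul, one_mul, hsum, sub_self, sub_zero]

lemma exists_isIntertwiner (hF : Admissible F) (hlam : IsPeripheralLabelling F lam) :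
    ∃ W : ℝ → X →L[ℂ] X, IsIntertwiner (projectorFamily F lam) W := by
  obtain ⟨W, hW0, hW⟩ := exists_linearODE_solution
    (K := fun s => ∑ i, derivWithin (projectorFamily F lam i) (Icc 0 1) s *
      projectorFamily F lam i s)
    (continuousOn_finsetSum _ fun i _ =>
      (contDiffOn_derivWithin_projectorFamily hF hlam i).continuousOn.mul
        (contDiffOn_projectorFamily hF hlam i).continuousOn)
  exact ⟨W, hW0, hW⟩

lemma IsIntertwiner.isTransported (hF : Admissible F) (hlam : IsPeripheralLabelling F lam)
    {W : ℝ → X →L[ℂ] X} (hW : IsIntertwiner (projectorFamily F lam) W) :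
    IsTransported (eigenProjector F lam)
      (fun m => derivWithin (eigenProjector F lam m) (Icc 0 1))
      (fun m s => W s * eigenProjector F lam m 0) := by
  have hint : ∀ m, ∀ s ∈ Icc (0 : ℝ) 1,
      eigenProjector F lam m s * W s = W s * eigenProjector F lam m 0 := fun m s hs =>
    projector_mul_intertwiner (P := projectorFamily F lam)
      (P' := fun i => derivWithin (projectorFamily F lam i) (Icc 0 1))
      (fun i t ht => hasDerivWithinAt_projectorFamily hF hlam i ht)
      (fun i => (contDiffOn_derivWithin_projectorFamily hF hlam i).continuousOn)
      (fun t ht => projectorFamily_orthogonal hF hlam ht)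
      (fun t ht => sum_projectorFamily hlam ht) hW.zero hW.hasDerivWithinAt (some m) hs
  refine ⟨fun m s hs => ?_, fun m s hs => ?_, fun m => by rw [hW.zero, one_mul]⟩
  · convert! (hW.hasDerivWithinAt s hs).mul_const (eigenProjector F lam m 0) using 1
    have h1 := generator_mul_projector (P := projectorFamily F lam)
      (P' := fun i => derivWithin (projectorFamily F lam i) (Icc 0 1))
      (fun t ht => projectorFamily_orthogonal hF hlam ht) (some m) hs
    change _ * eigenProjector F lam m s = derivWithin (eigenProjector F lam m) (Icc 0 1) s *
      eigenProjector F lam m s at h1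
    rw [mul_assoc, ← hint m s hs, ← mul_assoc, ← mul_assoc, h1]
  · rw [← mul_assoc, hint m s hs, mul_assoc, eigenProjector_orthogonal hF hlam
      ⟨le_rfl, zero_le_one⟩, if_pos rfl]

/-! ### Quantitative bounds -/

/-- A finite family of continuous functions on `[0,1]` has a common bound. -/
lemma exists_common_bound {ι E : Type*} [Fintype ι] [SeminormedAddCommGroup E] {f : ι → ℝ → E}
    (hf : ∀ i, ContinuousOn (f i) (Icc 0 1)) :
    ∃ C : ℝ, 0 ≤ C ∧ ∀ i, ∀ s ∈ Icc (0 : ℝ) 1, ‖f i s‖ ≤ C := by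
  choose C hC0 hC using fun i => exists_norm_le_of_continuousOn_Icc (hf i)
  exact ⟨∑ i, C i, Finset.sum_nonneg fun i _ => hC0 i, fun i s hs => (hC i s hs).trans
    (Finset.single_le_sum (fun i _ => hC0 i) (Finset.mem_univ i))⟩

lemma norm_le_projectorBound (hF : Admissible F) (hlam : IsPeripheralLabelling F lam)
    (i : Option (Fin z)) {s : ℝ} (hs : s ∈ Icc (0 : ℝ) 1) :
    ‖projectorFamily F lam i s‖ ≤ projectorBound (projectorFamily F lam) ∧
      ‖derivWithin (projectorFamily F lam i) (Icc 0 1) s‖ ≤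
        projectorBound (projectorFamily F lam) := by
  obtain ⟨C, -, hC⟩ := exists_common_bound
    fun i => (contDiffOn_projectorFamily hF hlam i).continuousOn
  obtain ⟨C', -, hC'⟩ := exists_common_bound
    fun i => (contDiffOn_derivWithin_projectorFamily hF hlam i).continuousOn
  have hbdd : BddAbove (range fun s : Icc (0 : ℝ) 1 => ⨆ i, max ‖projectorFamily F lam i s‖
      ‖derivWithin (projectorFamily F lam i) (Icc 0 1) s‖) := by
    refine ⟨max C C', ?_⟩
    rintro _ ⟨t, rfl⟩
    exact ciSup_le fun j => max_le_max (hC j t t.2) (hC' j t t.2)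
  have h1 : max ‖projectorFamily F lam i s‖
      ‖derivWithin (projectorFamily F lam i) (Icc 0 1) s‖ ≤
      projectorBound (projectorFamily F lam) :=
    (le_ciSup (f := fun j => max ‖projectorFamily F lam j s‖
      ‖derivWithin (projectorFamily F lam j) (Icc 0 1) s‖) (Set.finite_range _).bddAbove i).trans
      (le_ciSup hbdd ⟨s, hs⟩)
  exact max_le_iff.1 h1

/-- On the unit circle there is only room for boundedly many points with mutual distances at
least `δ`. -/
lemma exists_card_bound {δ : ℝ} (hδ : 0 < δ) : ∃ Z : ℕ, ∀ (z : ℕ) (e : Fin z → ℂ),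
    (∀ i, ‖e i‖ = 1) → (∀ i j, i ≠ j → δ ≤ ‖e i - e j‖) → z ≤ Z := by
  obtain ⟨t, -, ht⟩ := (isCompact_sphere (0 : ℂ) 1).elim_nhds_subcover
    (fun x => Metric.ball x (δ / 2)) fun x _ => Metric.ball_mem_nhds x (half_pos hδ)
  refine ⟨t.card, fun z e he hsep => ?_⟩
  have hcov : ∀ i, ∃ c ∈ t, dist (e i) c < δ / 2 := fun i => by
    have h1 : e i ∈ Metric.sphere (0 : ℂ) 1 := by simp [he i]
    simpa using ht h1
  choose c hct hc using hcov
  have hinj : Function.Injective c := by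
    intro i j hij
    by_contra hne
    have h1 := hsep i j hne
    rw [← dist_eq_norm] at h1
    have h2 := hc j
    rw [← hij] at h2
    linarith [dist_triangle_right (e i) (e j) (c i), hc i]
  simpa using Finset.card_le_card_of_injOn c (s := Finset.univ) (fun i _ => hct i) hinj.injOn

/-- The data of an admissible family in the form used for the discrete estimate. -/
lemma HasBounds.adiabaticData {δ M q r : ℝ} {N : ℕ} {ω : ℝ → ℝ} {B : ℝ} (hF : Admissible F)
    (hlam : IsPeripheralLabelling F lam) (hb : HasBounds F lam δ M q r N ω) (hδ : 0 < δ)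
    (h1 : 1 ≤ B) (hz : (z : ℝ) ≤ B) (hδB : δ⁻¹ ≤ B) (hM : M ≤ B) (hq : q ≤ B)
    (hP : projectorBound (projectorFamily F lam) ≤ B) :
    AdiabaticData F lam (eigenProjector F lam)
      (fun m => derivWithin (eigenProjector F lam m) (Icc 0 1))
      (fun m => derivWithin (derivWithin (eigenProjector F lam m) (Icc 0 1)) (Icc 0 1)) B where
  one_le := h1
  card_le := hz
  orthogonal s hs m n := eigenProjector_orthogonal hF hlam hs m n
  mul_projector s hs m := (hF.isPeripherallySemisimple hs).mul_projector (hlam.mem hs m)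
  projector_mul s hs m := (hF.isPeripherallySemisimple hs).projector_mul (hlam.mem hs m)
  norm_lam s hs m := (hF.isPeripherallySemisimple hs).norm_eq_one (hlam.mem hs m)
  lam_ne s hs m n hmn h := hmn (hlam.injective s hs h)
  norm_gap_inv_le s hs m n hmn := by
    rw [norm_inv]
    exact (inv_anti₀ hδ (hb.separation s hs m n hmn)).trans hδB
  lam_lipschitz s hs t ht m :=
    Convex.norm_image_sub_le_of_norm_hasDerivWithin_le
      (fun r hr => ((hlam.contDiffOn_eigenvalue hF m).differentiableOn (by norm_num) r
        hr).hasDerivWithinAt)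
      (fun r hr => (hb.deriv_eigenvalue r hr m).trans hM) (convex_Icc 0 1) ht hs
  hasDeriv m s hs := hasDerivWithinAt_projectorFamily hF hlam (some m) hs
  hasDeriv' m s hs := ((contDiffOn_derivWithin_projectorFamily hF hlam
    (some m)).differentiableOn (by norm_num) s hs).hasDerivWithinAt
  norm_projector_le s hs m := (norm_le_projectorBound hF hlam (some m) hs).1.trans hP
  norm_deriv_le s hs m := (norm_le_projectorBound hF hlam (some m) hs).2.trans hP
  norm_deriv_two_le s hs m := by
    have h2 := hb.deriv_two_projector s hs m
    rw [show (2 : ℕ) = 1 + 1 from rfl, iteratedDerivWithin_succ,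
      iteratedDerivWithin_one] at h2
    exact h2.trans hM
  norm_rest_le s hs := by
    rw [hlam.restProjector_eq hs]
    exact (norm_le_projectorBound hF hlam none hs).1.trans hP
  rest_lipschitz s hs t ht := by
    rw [hlam.restProjector_eq hs, hlam.restProjector_eq ht]
    exact Convex.norm_image_sub_le_of_norm_hasDerivWithin_le
      (fun r hr => hasDerivWithinAt_projectorFamily hF hlam none hr)
      (fun r hr => (norm_le_projectorBound hF hlam none hr).2.trans hP) (convex_Icc 0 1) ht hs
  norm_inner_le s hs := by
    rw [hlam.restProjector_eq hs]
    exact (hb.norm_inner s hs).trans hq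

end Bridge

end DiscreteAdiabatic

/-! ### The uniform estimate -/

namespace DiscreteAdiabatic

lemma errorConstant_nonneg {B : ℝ} (hB : 0 ≤ B) : 0 ≤ errorConstant B := by
  have := transportBound_nonneg hB
  unfold errorConstant
  positivity

lemma continuous_errorConstant : Continuous errorConstant := by
  unfold errorConstant transportBound
  fun_prop

/-- The adiabatic estimate with constants that depend on the family only through its quantitative
data and, continuously, through the bound `C_P` on the projectors. -/
theorem exists_uniform_adiabaticEstimate {l' δ M q r : ℝ} {N : ℕ} {ω : ℝ → ℝ} (hl1 : l' < 1)
    (hδ : 0 < δ) (hr0 : 0 ≤ r) (hrl : r < l') (hN : 1 ≤ N) (hω : Tendsto ω (𝓝[>] 0) (𝓝 0)) :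
    ∃ (c : ℝ → ℝ) (T₀ : ℝ → ℕ), Continuous c ∧ (∀ x, 0 < c x) ∧
      ∀ (X : Type u) [NormedAddCommGroup X] [NormedSpace ℂ X] [CompleteSpace X]
        (F : ℝ → X →L[ℂ] X) (z : ℕ) (lam : Fin z → ℝ → ℂ) (W : ℝ → X →L[ℂ] X),
        Admissible F → IsPeripheralLabelling F lam → IsIntertwiner (projectorFamily F lam) W →
        HasBounds F lam δ M q r N ω →
        AdiabaticEstimate F lam W l' (c (projectorBound (projectorFamily F lam)))
          (T₀ (projectorBound (projectorFamily F lam))) := by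
  have hl : 0 < l' := hr0.trans_lt hrl
  have hl' : 0 < 1 - l' := sub_pos.2 hl1
  have hrN : r ^ N < l' ^ N := pow_lt_pow_left₀ hrl hr0 (by omega)
  obtain ⟨Z, hZ⟩ := exists_card_bound hδ
  obtain ⟨t₀, ht₀, hωt⟩ : ∃ t₀ > 0, ∀ t, 0 < t → t < t₀ →
      N * max q 1 ^ N * ω t ≤ l' ^ N - r ^ N := by
    have h1 : Tendsto (fun t => N * max q 1 ^ N * ω t) (𝓝[>] 0) (𝓝 0) := by
      simpa using hω.const_mul ((N : ℝ) * max q 1 ^ N)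
    obtain ⟨t₀, ht₀, h2⟩ := mem_nhdsGT_iff_exists_Ioo_subset.1
      (h1.eventually (Iic_mem_nhds (sub_pos.2 hrN)))
    exact ⟨t₀, ht₀, fun t h0 ht => h2 ⟨h0, ht⟩⟩
  obtain ⟨n, hn⟩ := exists_nat_gt (N / t₀)
  rw [div_lt_iff₀ ht₀] at hn
  set D₀ : ℝ := (max q 1 / l') ^ N with hD₀
  have hD0 : 0 < D₀ := by
    have : 0 < max q 1 := lt_max_of_lt_right one_pos
    positivity
  -- the common bound for all the data, as a function of the bound on the projectors
  let b : ℝ → ℝ := fun x => 1 + Z + |x| + |M| + δ⁻¹ + max q 1 + D₀ + (1 - l')⁻¹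
  have hq1 : 1 ≤ max q 1 := le_max_right _ _
  have hZ0 : (0 : ℝ) ≤ Z := Nat.cast_nonneg Z
  have hδ0 : 0 < δ⁻¹ := inv_pos.2 hδ
  have hl0 : 0 < (1 - l')⁻¹ := inv_pos.2 hl'
  have hb1 : ∀ x, 1 ≤ b x := fun x => by
    simp only [b]
    linarith [abs_nonneg x, abs_nonneg M]
  refine ⟨fun x => errorConstant (b x) + D₀ * (|x| + 1), fun _ => n + 1, ?_, fun x => ?_, ?_⟩
  · exact (continuous_errorConstant.comp (by fun_prop)).add (by fun_prop)
  · have := errorConstant_nonneg (zero_le_one.trans (hb1 x))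
    positivity
  intro X _ _ _ F z lam W hF hlam hW hb T hT k hk1 hkT
  set C_P := projectorBound (projectorFamily F lam) with hCP
  have hE := errorConstant_nonneg (zero_le_one.trans (hb1 C_P))
  have hT0 : 0 < T := by omega
  have hT' : (0 : ℝ) < T := by exact_mod_cast hT0
  have hNT : (N : ℝ) < T * t₀ := by
    have h1 : (n : ℝ) ≤ T := by exact_mod_cast (Nat.le_succ n).trans hT
    exact hn.trans_le (mul_le_mul_of_nonneg_right h1 (le_of_lt ht₀))
  have hzero : (0 : ℝ) ∈ Icc (0 : ℝ) 1 := ⟨le_rfl, zero_le_one⟩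
  have hzZ : (z : ℝ) ≤ Z := by
    exact_mod_cast hZ z (fun m => lam m 0)
      (fun m => (hF.isPeripherallySemisimple hzero).norm_eq_one (hlam.mem hzero m))
      (hb.separation 0 hzero)
  obtain ⟨hbZ, hbδ, hbM, hbq, hbP, hbD, hbl⟩ : (Z : ℝ) ≤ b C_P ∧ δ⁻¹ ≤ b C_P ∧ |M| ≤ b C_P ∧
      max q 1 ≤ b C_P ∧ |C_P| ≤ b C_P ∧ D₀ ≤ b C_P ∧ (1 - l')⁻¹ ≤ b C_P := by
    simp only [b]
    refine ⟨?_, ?_, ?_, ?_, ?_, ?_, ?_⟩ <;> linarith [abs_nonneg C_P, abs_nonneg M]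
  have D := hb.adiabaticData (B := b C_P) hF hlam hδ (hb1 _) (hzZ.trans hbZ) hbδ
    ((le_abs_self M).trans hbM) ((le_max_left _ _).trans hbq) ((le_abs_self C_P).trans hbP)
  have hinner : ∀ j m, j + m ≤ T →
      stepProduct (fun i : ℕ => restProjector (eigenProjector F lam) ((i : ℝ) / T) *
        F ((i : ℝ) / T)) j m = stepProduct (fun i : ℕ => innerPart F ((i : ℝ) / T)) j m :=
    fun j m hjm => stepProduct_congr fun i hi => by
      rw [hlam.restProjector_eq (grid_mem (hi.trans hjm)), innerPart]
  have hdecay : ∀ j m, j + m ≤ T →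
      ‖stepProduct (fun i : ℕ => innerPart F ((i : ℝ) / T)) j m‖ ≤ D₀ * l' ^ m := fun j m hjm =>
    hb.norm_stepProduct_inner_le hF hl hl1.le hN hωt hrN.le hNT hT0 hjm
  have hd : InnerDecay F (eigenProjector F lam) (b C_P) l' T :=
    ⟨hl.le, hl1, hbl, fun j m hjm => by
      rw [hinner j m hjm]
      exact (hdecay j m hjm).trans (mul_le_mul_of_nonneg_right hbD
        (pow_nonneg hl.le m))⟩
  have herr := D.adiabatic_error (hW.isTransported hF hlam) hT0 hd hkT
  rw [hinner 0 k (by omega), hlam.restProjector_eq hzero] at herr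
  rw [orderedProduct_eq_stepProduct, orderedProduct_eq_stepProduct]
  constructor
  · refine herr.trans ?_
    rw [div_le_div_iff₀ hT' (mul_pos hT' hl')]
    have h1 : errorConstant (b C_P) * (1 - l') ≤ errorConstant (b C_P) + D₀ * (|C_P| + 1) := by
      have h2 : 0 ≤ D₀ * (|C_P| + 1) := by positivity
      have h3 : errorConstant (b C_P) * (1 - l') ≤ errorConstant (b C_P) :=
        mul_le_of_le_one_right hE (by linarith)
      linarith
    calc _ = errorConstant (b C_P) * (1 - l') * T := by ring
      _ ≤ _ := mul_le_mul_of_nonneg_right h1 hT'.le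
  · have hQ : ‖complProjector (F 0)‖ ≤ |C_P| + 1 :=
      ((norm_le_projectorBound hF hlam none hzero).1.trans (le_abs_self _)).trans
        (le_add_of_nonneg_right zero_le_one)
    calc _ ≤ D₀ * l' ^ k * (|C_P| + 1) :=
          (norm_mul_le _ _).trans (mul_le_mul (hdecay 0 k (by omega)) hQ (norm_nonneg _)
            (by positivity))
      _ = D₀ * (|C_P| + 1) * l' ^ k := by ring
      _ ≤ _ := mul_le_mul_of_nonneg_right (le_add_of_nonneg_left hE) (pow_nonneg hl.le k)

/-! ### Quantitative data of a single family -/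

section Compactness

variable {X : Type u} [NormedAddCommGroup X] [NormedSpace ℂ X] [CompleteSpace X]
  {F : ℝ → X →L[ℂ] X} {z : ℕ} {lam : Fin z → ℝ → ℂ}

lemma continuousOn_innerPart (hF : Admissible F) (hlam : IsPeripheralLabelling F lam) :
    ContinuousOn (innerPart F) (Icc 0 1) :=
  (contDiffOn_projectorFamily hF hlam none).continuousOn.mul hF.continuousOn

/-- If `a` is continuous on `[0,1]` and all spectral radii are below `r`, then one power `N` has
`‖a(s)^N‖ ≤ r^N` for all `s`, by Gelfand's formula and compactness. -/
lemma exists_pow_norm_le {𝔸 : Type*} [NormedRing 𝔸] [NormedAlgebra ℂ 𝔸] [CompleteSpace 𝔸]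
    {a : ℝ → 𝔸} (ha : ContinuousOn a (Icc 0 1)) {r : ℝ}
    (hr : ∀ s ∈ Icc (0 : ℝ) 1, spectralRadius ℂ (a s) < ENNReal.ofReal r) :
    ∃ N : ℕ, 1 ≤ N ∧ ∀ s ∈ Icc (0 : ℝ) 1, ‖a s ^ N‖ ≤ r ^ N := by
  refine isCompact_Icc.induction_on (p := fun S => ∃ N : ℕ, 1 ≤ N ∧ ∀ s ∈ S, ‖a s ^ N‖ ≤ r ^ N)
    ⟨1, le_rfl, by simp⟩ (fun S S' hS ⟨N, hN, h⟩ => ⟨N, hN, fun s hs => h s (hS hs)⟩) ?_ ?_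
  · rintro S S' ⟨N, hN, h⟩ ⟨N', hN', h'⟩
    refine ⟨N * N', Nat.mul_pos hN hN', fun s hs => ?_⟩
    rcases hs with hs | hs
    · rw [pow_mul, pow_mul]
      exact (norm_pow_le' _ hN').trans (pow_le_pow_left₀ (norm_nonneg _) (h s hs) N')
    · rw [mul_comm, pow_mul, pow_mul]
      exact (norm_pow_le' _ hN).trans (pow_le_pow_left₀ (norm_nonneg _) (h' s hs) N)
  · intro s hs
    have hr0 : 0 < r := ENNReal.ofReal_pos.1 (zero_le.trans_lt (hr s hs))
    have hgelfand := spectrum.pow_norm_pow_one_div_tendsto_nhds_spectralRadius (a s)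
    obtain ⟨N, hlt, hN⟩ := ((hgelfand.eventually (Iio_mem_nhds (hr s hs))).and
      (eventually_ge_atTop 1)).exists
    have hN0 : N ≠ 0 := by omega
    have hlt' : ‖a s ^ N‖ < r ^ N := by
      have h1 : ‖a s ^ N‖ ^ (1 / N : ℝ) < r := (ENNReal.ofReal_lt_ofReal_iff hr0).1 hlt
      rw [one_div] at h1
      have h2 := pow_lt_pow_left₀ h1 (by positivity) hN0
      rwa [Real.rpow_inv_natCast_pow (norm_nonneg _) hN0] at h2
    have hev := ((ha.pow N).norm s hs).eventually (Iio_mem_nhds hlt')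
    exact ⟨_, hev, N, hN, fun t ht => le_of_lt ht⟩

lemma exists_modulus {E : Type*} [SeminormedAddCommGroup E] {f : ℝ → E}
    (hf : ContinuousOn f (Icc 0 1)) : ∃ ω : ℝ → ℝ, Tendsto ω (𝓝[>] 0) (𝓝 0) ∧
      ∀ s ∈ Icc (0 : ℝ) 1, ∀ t ∈ Icc (0 : ℝ) 1, ‖f s - f t‖ ≤ ω |s - t| := by
  let S : ℝ → Set ℝ := fun d =>
    {x | ∃ s ∈ Icc (0 : ℝ) 1, ∃ t ∈ Icc (0 : ℝ) 1, |s - t| = d ∧ x = ‖f s - f t‖}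
  obtain ⟨C, hC0, hC⟩ := exists_norm_le_of_continuousOn_Icc hf
  have hbdd : ∀ d, BddAbove (S d) := fun d => by
    refine ⟨C + C, ?_⟩
    rintro _ ⟨s, hs, t, ht, -, rfl⟩
    exact (norm_sub_le _ _).trans (add_le_add (hC s hs) (hC t ht))
  refine ⟨fun d => sSup (S d), ?_, fun s hs t ht => le_csSup (hbdd _) ⟨s, hs, t, ht, rfl, rfl⟩⟩
  have hnonneg : ∀ d, 0 ≤ sSup (S d) := fun d => Real.sSup_nonneg (by
    rintro _ ⟨s, -, t, -, -, rfl⟩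
    exact norm_nonneg _)
  have huc := isCompact_Icc.uniformContinuousOn_of_continuous hf
  rw [Metric.uniformContinuousOn_iff] at huc
  rw [Metric.tendsto_nhds]
  intro ε hε
  obtain ⟨d₀, hd₀, h⟩ := huc (ε / 2) (half_pos hε)
  filter_upwards [Ioo_mem_nhdsGT hd₀] with d hd
  rw [Real.dist_0_eq_abs, abs_of_nonneg (hnonneg d)]
  refine lt_of_le_of_lt (Real.sSup_le ?_ (half_pos hε).le) (half_lt_self hε)
  rintro _ ⟨s, hs, t, ht, hst, rfl⟩
  rw [← dist_eq_norm]
  exact (h s hs t ht (by rw [Real.dist_eq, hst]; exact hd.2)).le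

lemma spectralRadius_innerPart_le (hF : Admissible F) {s : ℝ} (hs : s ∈ Icc (0 : ℝ) 1) :
    spectralRadius ℂ (innerPart F s) ≤ innerRadius F := by
  have hcomm : innerPart F s = F s * complProjector (F s) :=
    (((Commute.one_right (F s)).sub_right
      (hF.isPeripherallySemisimple hs).commute_peripheralProjector).eq).symm
  rw [hcomm, innerRadius]
  exact le_iSup₂ (f := fun t (_ : t ∈ Icc (0 : ℝ) 1) =>
    spectralRadius ℂ (F t * complProjector (F t))) s hs

/-- By compactness of `[0,1]`, every admissible family has quantitative data, for each rate
`l'` above the inner spectral radius. -/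
lemma exists_hasBounds (hF : Admissible F) (hlam : IsPeripheralLabelling F lam) {l' : ℝ}
    (hl : innerRadius F < ENNReal.ofReal l') :
    ∃ (δ M q r : ℝ) (N : ℕ) (ω : ℝ → ℝ), 0 < δ ∧ 0 ≤ r ∧ r < l' ∧ 1 ≤ N ∧
      Tendsto ω (𝓝[>] 0) (𝓝 0) ∧ HasBounds F lam δ M q r N ω := by
  obtain ⟨r', hr', hr'l⟩ := exists_between hl
  have hr'top : r' ≠ ⊤ := (hr'l.trans ENNReal.ofReal_lt_top).ne
  have hl0 : 0 < l' := ENNReal.ofReal_pos.1 (zero_le.trans_lt hl)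
  have hrr' : ENNReal.ofReal r'.toReal = r' := ENNReal.ofReal_toReal hr'top
  have hrl : r'.toReal < l' := by
    rw [← hrr'] at hr'l
    exact (ENNReal.ofReal_lt_ofReal_iff hl0).1 hr'l
  have hcont := continuousOn_innerPart hF hlam
  obtain ⟨N, hN, hpow⟩ := exists_pow_norm_le hcont (r := r'.toReal) fun s hs => by
    rw [hrr']
    exact (spectralRadius_innerPart_le hF hs).trans_lt hr'
  obtain ⟨ω, hω, hmod⟩ := exists_modulus hcont
  obtain ⟨q, -, hq⟩ := exists_norm_le_of_continuousOn_Icc hcont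
  obtain ⟨M₁, hM₁0, hM₁⟩ := exists_common_bound fun m =>
    (hlam.contDiffOn_eigenvalue hF m).continuousOn_derivWithin uniqueDiffOn_Icc_zero_one
      (by norm_num)
  obtain ⟨M₂, hM₂0, hM₂⟩ := exists_common_bound fun m =>
    (hlam.contDiffOn_eigenProjector hF m).continuousOn_iteratedDerivWithin (m := 2) le_rfl
      uniqueDiffOn_Icc_zero_one
  -- the inverses of the differences of distinct eigenvalues are bounded
  obtain ⟨K, hK0, hK⟩ := exists_common_bound (ι := Fin z × Fin z)
    (f := fun p s => if p.1 = p.2 then 0 else (lam p.1 s - lam p.2 s)⁻¹) fun p => by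
      by_cases hp : p.1 = p.2
      · simpa only [if_pos hp] using continuousOn_const
      · simp only [if_neg hp]
        exact ((hlam.continuousOn p.1).sub (hlam.continuousOn p.2)).inv₀ fun s hs h =>
          hp (hlam.injective s hs (sub_eq_zero.1 h))
  refine ⟨(K + 1)⁻¹, M₁ + M₂, q, r'.toReal, N, ω, by positivity, ENNReal.toReal_nonneg, hrl, hN,
    hω, fun s hs i j hij => ?_, fun s hs m => (hM₁ m s hs).trans (by linarith),
    fun s hs m => (hM₂ m s hs).trans (by linarith), hq, hpow, hmod⟩
  have h1 := hK (i, j) s hs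
  simp only [if_neg hij, norm_inv] at h1
  have hpos : 0 < ‖lam i s - lam j s‖ := norm_pos_iff.2 (sub_ne_zero.2 fun h =>
    hij (hlam.injective s hs h))
  rw [inv_le_comm₀ (by positivity) hpos]
  linarith

end Compactness

end DiscreteAdiabatic

theorem theoremB4 :
    (∀ (X : Type u) [NormedAddCommGroup X] [NormedSpace ℂ X] [CompleteSpace X]
        (F : ℝ → X →L[ℂ] X), DiscreteAdiabatic.Admissible F →
      (∃ (z : ℕ) (lam : Fin z → ℝ → ℂ), DiscreteAdiabatic.IsPeripheralLabelling F lam) ∧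
      ∀ (z : ℕ) (lam : Fin z → ℝ → ℂ), DiscreteAdiabatic.IsPeripheralLabelling F lam →
        (∀ m, ContDiffOn ℝ 2 (lam m) (Icc 0 1)) ∧
        (∀ m, ContDiffOn ℝ 2 (DiscreteAdiabatic.eigenProjector F lam m) (Icc 0 1)) ∧
        (∃ W : ℝ → X →L[ℂ] X,
          DiscreteAdiabatic.IsIntertwiner (DiscreteAdiabatic.projectorFamily F lam) W) ∧
        ∀ W : ℝ → X →L[ℂ] X,
          DiscreteAdiabatic.IsIntertwiner (DiscreteAdiabatic.projectorFamily F lam) W →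
          ∀ l' : ℝ, DiscreteAdiabatic.innerRadius F < ENNReal.ofReal l' → l' < 1 →
            ∃ (C : ℝ) (T₀ : ℕ), 0 < C ∧
              DiscreteAdiabatic.AdiabaticEstimate F lam W l' C T₀) ∧
    (∀ (l' δ M q r : ℝ) (N : ℕ) (ω : ℝ → ℝ), l' < 1 → 0 < δ → 0 ≤ r → r < l' → 1 ≤ N →
      Tendsto ω (𝓝[>] 0) (𝓝 0) →
      ∃ (c : ℝ → ℝ) (T₀ : ℝ → ℕ), Continuous c ∧ (∀ x, 0 < c x) ∧
        ∀ (X : Type u) [NormedAddCommGroup X] [NormedSpace ℂ X] [CompleteSpace X]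
          (F : ℝ → X →L[ℂ] X) (z : ℕ) (lam : Fin z → ℝ → ℂ) (W : ℝ → X →L[ℂ] X),
          DiscreteAdiabatic.Admissible F →
          DiscreteAdiabatic.IsPeripheralLabelling F lam →
          DiscreteAdiabatic.IsIntertwiner (DiscreteAdiabatic.projectorFamily F lam) W →
          DiscreteAdiabatic.HasBounds F lam δ M q r N ω →
          DiscreteAdiabatic.AdiabaticEstimate F lam W l'
            (c (DiscreteAdiabatic.projectorBound (DiscreteAdiabatic.projectorFamily F lam)))
            (T₀ (DiscreteAdiabatic.projectorBound (DiscreteAdiabatic.projectorFamily F lam)))) := by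
  refine ⟨fun X _ _ _ F hF => ⟨hF.exists_labelling, fun z lam hlam =>
    ⟨hlam.contDiffOn_eigenvalue hF, hlam.contDiffOn_eigenProjector hF,
      DiscreteAdiabatic.exists_isIntertwiner hF hlam, fun W hW l' hl hl1 => ?_⟩⟩,
    fun l' δ M q r N ω hl1 hδ hr0 hrl hN hω =>
      DiscreteAdiabatic.exists_uniform_adiabaticEstimate hl1 hδ hr0 hrl hN hω⟩
  obtain ⟨δ, M, q, r, N, ω, hδ, hr0, hrl, hN, hω, hb⟩ :=
    DiscreteAdiabatic.exists_hasBounds hF hlam hl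
  obtain ⟨c, T₀, -, hc, h⟩ :=
    DiscreteAdiabatic.exists_uniform_adiabaticEstimate.{u} hl1 hδ hr0 hrl hN hω
  exact ⟨_, _, hc _, h X F z lam W hF hlam hW hb⟩
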